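/- Let $G\subset\{0,1\}^{24}$ be the extended binary Golay code spanned modulo 2 by the 12 rows 100000000000011111111111, 010000000000110100011101, 001000000000101000111011, 000100000000110001110110, 000010000000100011101101, 000001000000100111011010, 000000100000101110110100, 000000010000111101101000, 000000001000111011010001, 000000000100110110100011, 000000000010101101000111, 000000000001111010001110. The (unscaled) Leech lattice $\Lambda\subset\mathbf Z^{24}\subset\mathbf R^{24}$ is the set of all $x=(x_1,\dots,x_{24})$ with $x_i=a+2b_i+4c_i+8d_i$ for all $i$, where $a\in\{0,1\}$, $(b_1,\dots,b_{24})\in G$, $c_i\in\{0,1\}$, $d_i\in\mathbf Z$ and $\sum_i c_i\equiv a\pmod 2$. Number the coordinates anew by $y_k=x_{\sigma(k)}$, where $(\sigma(1),\dots,\sigma(24))=(1,5,6,13,3,7,11,14,2,4,10,15,8,16,17,19,9,12,18,20,21,22,23,24)$. (The supports $\sigma\{1,\dots,8\}$, $\sigma\{9,\dots,16\}$, $\sigma\{17,\dots,24\}$ and the unions of any two of $\sigma\{1,..,4\}$, $\sigma\{5,..,8\}$, $\sigma\{9,..,12\}$, $\sigma\{13,..,16\}$ are words of $G$.) Put $\Lambda_{24}=\Lambda$,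 and for $n=23,22,\dots,1$ let the laminated lattice $\Lambda_n$ be the set of the vectors of $\Lambda_{n+1}$ that satisfy the following condition: $n=23$: $y_{24}=y_{23}$; $22$: $y_{23}=y_{22}$; $21$: $y_{22}=0$; $20$: $y_{21}=0$; $19$: $y_{20}=0$; $18$: $y_{19}+y_{18}+y_{17}=0$; $17$: $y_{19}=0$; $16$: $y_{18}=0$; $15$: $y_{16}=0$; $14$: $y_{15}+y_{14}+y_{13}=0$; $13$: $y_{15}=0$; $12$: $y_{14}=0$; $11$: $y_{12}=y_{11}$; $10$: $y_{11}=y_{10}$; $9$: $y_{10}=0$; $8$: $y_9=0$; $7$: $y_8=y_7$; $6$: $y_7=y_6$; $5$: $y_6=0$; $4$: $y_5=0$; $3$: $y_4=0$; $2$: $y_3+y_2+y_1=0$; $1$: $y_3=0$. (In dimensions 11, 12, 13 these are the laminated lattices $\Lambda_n^{\max}$.) Let $M_n$ be the set of the vectors of norm $\sqrt{32}$ in $\Lambda_n$, and let $H_n$ be the set of all subsets of $M_n$ that contain exactly one of $x$ and $-x$ for each $x\in M_n$. **Theorem.** Let $1\le n\le 21$. Then $\Lambda_n$ spans an $n$-dimensional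 space, and $M_n$ can be divided into at most $n+1$ parts, each of diameter below $\sqrt{96}$. Hence every $S\in H_n$ can be divided into at most $n+1$ parts of diameter below $\sqrt{96}$. For $n\ge 2$ each $S\in H_n$ has diameter exactly $\sqrt{96}$ (for $n=1$ it is a single point). Consequently no element of $H_n$ is a counterexample to Borsuk's conjecture in dimension $n$, that is, a bounded set with at least two points in an $n$-dimensional Euclidean space that cannot be divided into $n+1$ parts of smaller diameter. -/

import Mathlib

/-- The generator matrix of the extended binary Golay code. -/
def golayMatrix : Matrix (Fin 12) (Fin 24) (ZMod 2) :=
  !![1,0,0,0,0,0,0,0,0,0,0,0,0,1,1,1,1,1,1,1,1,1,1,1;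
     0,1,0,0,0,0,0,0,0,0,0,0,1,1,0,1,0,0,0,1,1,1,0,1;
     0,0,1,0,0,0,0,0,0,0,0,0,1,0,1,0,0,0,1,1,1,0,1,1;
     0,0,0,1,0,0,0,0,0,0,0,0,1,1,0,0,0,1,1,1,0,1,1,0;
     0,0,0,0,1,0,0,0,0,0,0,0,1,0,0,0,1,1,1,0,1,1,0,1;
     0,0,0,0,0,1,0,0,0,0,0,0,1,0,0,1,1,1,0,1,1,0,1,0;
     0,0,0,0,0,0,1,0,0,0,0,0,1,0,1,1,1,0,1,1,0,1,0,0;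
     0,0,0,0,0,0,0,1,0,0,0,0,1,1,1,1,0,1,1,0,1,0,0,0;
     0,0,0,0,0,0,0,0,1,0,0,0,1,1,1,0,1,1,0,1,0,0,0,1;
     0,0,0,0,0,0,0,0,0,1,0,0,1,1,0,1,1,0,1,0,0,0,1,1;
     0,0,0,0,0,0,0,0,0,0,1,0,1,0,1,1,0,1,0,0,0,1,1,1;
     0,0,0,0,0,0,0,0,0,0,0,1,1,1,1,0,1,0,0,0,1,1,1,0]

/-- The extended binary Golay code: the 4096 combinations modulo 2 of the rows of the matrix. -/
def golayCode : Submodule (ZMod 2) (Fin 24 → ZMod 2) :=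
  Submodule.span (ZMod 2) (Set.range golayMatrix.row)

/-- The (unscaled) Leech lattice: the integer vectors with `x i = a + 2 b i + 4 c i + 8 d i`, where
`a` and the `c i` are 0 or 1, `b` is a word of the Golay code, and `∑ c i ≡ a (mod 2)`. -/
def leechLattice : Set (Fin 24 → ℤ) :=
  {x | ∃ a : ℤ, (a = 0 ∨ a = 1) ∧ ∃ b ∈ golayCode, ∃ c d : Fin 24 → ℤ,
    (∀ i, c i = 0 ∨ c i = 1) ∧ (∑ i, c i) ≡ a [ZMOD 2] ∧
    ∀ i, x i = a + 2 * ((b i).val : ℤ) + 4 * c i + 8 * d i}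

/-- The order in which the 24 coordinates (numbered from 1 in this list) are run through in the
definition of the laminated sublattices. The places 1-8, 9-16 and 17-24 of the list hold words of
weight 8 of the Golay code, and so do any two of the blocks 1-4, 5-8, 9-12, 13-16. -/
def coordOrder : List ℕ :=
  [1, 5, 6, 13, 3, 7, 11, 14, 2, 4, 10, 15, 8, 16, 17, 19, 9, 12, 18, 20, 21, 22, 23, 24]

/-- The `k`-th coordinate of `x`, for `k` from 1 to 24, in the order of `coordOrder`. -/
def coord (x : Fin 24 → ℤ) (k : ℕ) : ℤ :=
  x (Fin.ofNat 24 (coordOrder.getD (k - 1) 1 - 1))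

/-- The linear condition that cuts the laminated lattice of dimension `n` out of that of dimension
`n + 1`. -/
def addedCondition (x : Fin 24 → ℤ) : ℕ → Prop
  | 23 => coord x 24 = coord x 23
  | 22 => coord x 23 = coord x 22
  | 21 => coord x 22 = 0
  | 20 => coord x 21 = 0
  | 19 => coord x 20 = 0
  | 18 => coord x 19 + coord x 18 + coord x 17 = 0
  | 17 => coord x 19 = 0
  | 16 => coord x 18 = 0
  | 15 => coord x 16 = 0
  | 14 => coord x 15 + coord x 14 + coord x 13 = 0
  | 13 => coord x 15 = 0
  | 12 => coord x 14 = 0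
  | 11 => coord x 12 = coord x 11
  | 10 => coord x 11 = coord x 10
  | 9 => coord x 10 = 0
  | 8 => coord x 9 = 0
  | 7 => coord x 8 = coord x 7
  | 6 => coord x 7 = coord x 6
  | 5 => coord x 6 = 0
  | 4 => coord x 5 = 0
  | 3 => coord x 4 = 0
  | 2 => coord x 3 + coord x 2 + coord x 1 = 0
  | 1 => coord x 3 = 0
  | _ => True

/-- An integer vector as a point of 24-dimensional Euclidean space. -/
noncomputable def toEuclidean24 (x : Fin 24 → ℤ) : EuclideanSpace ℝ (Fin 24) :=
  WithLp.toLp 2 fun i => (x i : ℝ)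

/-- The laminated sublattice `Λ_n` of the Leech lattice, `1 ≤ n ≤ 24` (in the dimensions 11, 12, 13
the one with the most minimal vectors): the vectors of the Leech lattice that satisfy the conditions
added at the dimensions `23, 22, …, n`. -/
def laminatedLattice (n : ℕ) : Set (EuclideanSpace ℝ (Fin 24)) :=
  toEuclidean24 '' {x | x ∈ leechLattice ∧ ∀ m, n ≤ m → m ≤ 23 → addedCondition x m}

/-- `M_n`: the vectors of norm `√32` of `Λ_n`. -/
def minimalVectors (n : ℕ) : Set (EuclideanSpace ℝ (Fin 24)) :=
  {v | v ∈ laminatedLattice n ∧ ‖v‖ = √32}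

/-- `H_n`: the subsets of `M_n` that contain exactly one of `v`, `-v` for each `v` in `M_n`. -/
def halfSystems (n : ℕ) : Set (Set (EuclideanSpace ℝ (Fin 24))) :=
  {S | S ⊆ minimalVectors n ∧ ∀ v ∈ minimalVectors n, Xor (v ∈ S) (-v ∈ S)}

/-- `S` can be divided into at most `k` parts (some of the `P i` may be empty), each of diameter
below `d`. -/
def DivisibleInto {m : ℕ} (S : Set (EuclideanSpace ℝ (Fin m))) (k : ℕ) (d : ℝ) : Prop :=
  ∃ P : Fin k → Set (EuclideanSpace ℝ (Fin m)),
    (⋃ i, P i) = S ∧ (∀ i j, i ≠ j → Disjoint (P i) (P j)) ∧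
    ∀ i, Bornology.IsBounded (P i) ∧ Metric.diam (P i) < d

/-- `S` is a counterexample to Borsuk's conjecture in dimension `n`: a bounded set with at least two
points, lying in an `n`-dimensional Euclidean space (here an affine subspace of dimension at most `n`
of some `ℝ^m`), that cannot be divided into `n + 1` parts of smaller diameter. -/
def IsBorsukCounterexample {m : ℕ} (n : ℕ) (S : Set (EuclideanSpace ℝ (Fin m))) : Prop :=
  Bornology.IsBounded S ∧ S.Nontrivial ∧ Module.finrank ℝ (vectorSpan ℝ S) ≤ n ∧
    ¬ DivisibleInto S (n + 1) (Metric.diam S)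

/-! For `n ≤ 21` a coordinate vanishes on the lattice, so all coordinates are even. A halved vector
`z` reduces modulo 2 to a Golay word and has coordinate sum divisible by 4. Since nonzero words have
weight at least 8, the halves of minimal vectors, with `∑ z i ^ 2 = 8`, are of two kinds: eight
entries `±1` with evenly many `1` (octad vectors), or two entries `±2` (pair vectors). Squared
distances of the originals are `64 - 8 ∑ z i * w i`, so it suffices to find `n + 1` colours such
that no two vectors of one colour have halves with inner product at most `-4`; this is
`neg_three_le_dot24_of_colour_eq`.

A colour `0 < a < n` is given only to vectors positive at place `a`. Two octads that differ share at
most four places, one of which then contributes `+1`, so the product is at least `-2`; for a pair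
vector the common positive place outweighs or balances the other one. On one and the same octad this
is not enough, since two patterns may differ at six other places. There a table colours the sign
patterns so that those assigned to the same place differ in at most four signs
(`patternColour_check`).

The colours `0` and `n` take the remaining vectors: octad vectors with at most two entries `1`, and
pair vectors not positive at any place strictly between `0` and `n`. If two such octad vectors have
product at most `-4`, each entry `1` of one faces `-1` in the other (`eq_neg_one_of_dot24_le`). The
classes `OctadLow` and `OctadHigh` prescribe where an entry `1` stands, which makes this impossible.

The sum of two non-opposite halves is a nonzero vector of squared norm at least 8, whence the
diameter is at most `√96`. Equality comes from three minimal vectors at mutual angles of 120 degrees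
(`hexagon`): a half system contains two of them or the negatives of two. The dimension follows from
a strictly increasing chain of spans. -/

/-! ### Weights of the Golay code -/

/-- The word of length 24 whose letters are the binary digits of `m`. -/
def wordOfNat (m : ℕ) : Fin 24 → ZMod 2 := fun i => if m.testBit i then 1 else 0

/-- The number of ones among the `k` lowest binary digits of `m`. -/
def bitCount : ℕ → ℕ → ℕ
  | 0, _ => 0
  | k + 1, m => m % 2 + bitCount k (m / 2)

/-- The sums modulo 2 of the sublists of a list of binary words. -/
def xorSums : List ℕ → List ℕ
  | [] => [0]
  | r :: rs => xorSums rs ++ (xorSums rs).map (r ^^^ ·)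

/-- The rows of the generator matrix of the Golay code, the first letter as the lowest digit. -/
def golayRows : List ℕ :=
  [0xffe001, 0xb8b002, 0xdc5004, 0x6e3008, 0xb71010, 0x5b9020, 0x2dd040, 0x16f080, 0x8b7100,
    0xc5b200, 0xe2d400, 0x717800]

theorem sum_testBit_eq_bitCount (k m : ℕ) :
    ∑ i : Fin k, (if m.testBit i then 1 else 0) = bitCount k m := by
  induction k generalizing m with
  | zero => simp [bitCount]
  | succ k ih =>
    rw [Fin.sum_univ_succ, bitCount, ← ih]
    congr 1
    · rcases Nat.mod_two_eq_zero_or_one m with h | h <;> simp [Nat.testBit_zero, h]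
    · simp [Nat.testBit_succ]

theorem sum_val_wordOfNat (m : ℕ) : ∑ i, (wordOfNat m i).val = bitCount 24 m := by
  rw [← sum_testBit_eq_bitCount]
  refine Finset.sum_congr rfl fun i _ => ?_
  unfold wordOfNat
  split_ifs <;> rfl

theorem wordOfNat_xor (m k : ℕ) : wordOfNat (m ^^^ k) = wordOfNat m + wordOfNat k := by
  funext i
  simp only [wordOfNat, Pi.add_apply, Nat.testBit_xor]
  cases m.testBit i <;> cases k.testBit i <;> decide

/-- Over the field of two elements a span consists of the subset sums of its generators; this makes
the code a finite list of numbers that can be checked by evaluation. -/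
theorem exists_mem_xorSums {rs : List ℕ} {b : Fin 24 → ZMod 2}
    (hb : b ∈ Submodule.span (ZMod 2) (wordOfNat '' {r | r ∈ rs})) :
    ∃ m ∈ xorSums rs, wordOfNat m = b := by
  induction rs generalizing b with
  | nil =>
    refine ⟨0, by simp [xorSums], ?_⟩
    have : b = 0 := by simpa using hb
    rw [this]
    funext i
    simp [wordOfNat]
  | cons r rs ih =>
    have hset : {x | x ∈ r :: rs} = insert r {x | x ∈ rs} := by
      ext x; simp
    rw [hset, Set.image_insert_eq, Submodule.mem_span_insert] at hb
    obtain ⟨a, z, hz, rfl⟩ := hb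
    obtain ⟨m, hm, rfl⟩ := ih hz
    have ha : a = 0 ∨ a = 1 := by revert a; decide
    rcases ha with rfl | rfl
    · exact ⟨m, by simp [xorSums, hm], by simp⟩
    · refine ⟨r ^^^ m, ?_, by rw [wordOfNat_xor, one_smul]⟩
      simp only [xorSums, List.mem_append, List.mem_map]
      exact Or.inr ⟨m, hm, rfl⟩

theorem golayMatrix_row_eq (i : Fin 12) :
    golayMatrix.row i = wordOfNat (golayRows.getD i 0) := by
  revert i
  decide +kernel

theorem bitCount_golay :
    ((xorSums golayRows).all fun m => m == 0 ||
      (bitCount 24 m % 4 == 0 && Nat.ble 8 (bitCount 24 m))) = true := by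
  decide +kernel

/-- Read off from the enumeration of all 4096 words. Divisibility by 4 controls the coordinate sum
of halved vectors, the bound 8 their norm. -/
theorem golay_weight {b : Fin 24 → ZMod 2} (hb : b ∈ golayCode) :
    4 ∣ ∑ i, (b i).val ∧ (b ≠ 0 → 8 ≤ ∑ i, (b i).val) := by
  have hsub : b ∈ Submodule.span (ZMod 2) (wordOfNat '' {r | r ∈ golayRows}) := by
    refine Submodule.span_mono ?_ hb
    rintro _ ⟨i, rfl⟩
    rw [golayMatrix_row_eq]
    refine ⟨_, ?_, rfl⟩
    revert i
    decide
  obtain ⟨m, hm, rfl⟩ := exists_mem_xorSums hsub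
  have h := List.all_eq_true.1 bitCount_golay m hm
  rw [sum_val_wordOfNat]
  simp only [Bool.or_eq_true, beq_iff_eq, Bool.and_eq_true, Nat.ble_eq] at h
  rcases h with rfl | h
  · refine ⟨by decide, fun h => absurd (funext fun i => ?_) h⟩
    simp [wordOfNat]
  · exact ⟨Nat.dvd_of_mod_eq_zero h.1, fun _ => h.2⟩

/-! ### Colouring the sign patterns of one octad -/

/-- The colours of the sign patterns on an octad, one hexadecimal digit for each pattern: 0 to 7 for
a place of the octad, 8 and 9 for the two classes that belong to no place. The first flag tells
whether the octad contains the coordinate 0, the second whether the signs at the last two places are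
bound to be opposite. -/
def patternColours : Bool → Bool → ℕ
  | true, false =>
    0x14555156222515553335155522521155466616661466116633663166222619864774145724474175333733752222198744474774447419873373398729878988
  | false, false =>
    0x05551106220615553306155522221105460606662666410636663106222616964705155524474105333733352225119744474774477444973773339772979798
  | true, true =>
    0x01601006100601601006016001201006100601600120100601201003100201600440400440040440500505500550500540040440044040040330300320020980
  | false, true =>
    0x06000003000606000003010006000006000301000600000601000003000201000440400440040440500505500550500540040440044040040220100320020190

/-- The colour of the sign pattern `p`; binary digit 1 stands for the sign `+`. The highest digit is
not read, since it follows from the others by parity. -/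
def patternColour (z o : Bool) (p : ℕ) : ℕ := (patternColours z o >>> (4 * (p % 128))) % 16

/-- What is asked of the colour `g` of the sign pattern `p`. -/
def colourAllowed (z o : Bool) (p g : ℕ) : Bool :=
  if g < 8 then
    p.testBit g && !(z && g == 0) &&
      (if o then g != 7
      else p.testBit 6 != p.testBit 7 || (g != 7 && (p.testBit 5 != p.testBit 6 || g != 6)))
  else if g == 8 then p == 0 || (z && bitCount 8 p == 2 && p.testBit 0)
  else g == 9 && bitCount 8 p == 2 && (if z then !p.testBit 0 && p.testBit 1 else p.testBit 0) &&
    (!o || p.testBit 7)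

/-- The sign patterns with an even number of minus signs. -/
def signPatterns (o : Bool) : List ℕ :=
  (List.range 256).filter fun p => bitCount 8 p % 2 == 0 && (!o || p.testBit 6 != p.testBit 7)

/-- The finite certificate for the table. Differing in at most four of eight signs means a
nonnegative inner product. The colours 8 and 9 are exempt from the pairwise test: their vectors are
separated by the positions of their few plus signs, which also works across different octads. -/
theorem patternColour_check (z o : Bool) :
    ((signPatterns o).all fun p => colourAllowed z o p (patternColour z o p) &&
      (signPatterns o).all fun q => patternColour z o p != patternColour z o q ||
        Nat.ble 8 (patternColour z o p) || Nat.ble (bitCount 8 (p ^^^ q)) 4) = true := by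
  cases z <;> cases o <;> decide +kernel

theorem mem_signPatterns {o : Bool} {p : ℕ} :
    p ∈ signPatterns o ↔ p < 256 ∧ bitCount 8 p % 2 = 0 ∧
      (o = true → p.testBit 6 ≠ p.testBit 7) := by
  cases o <;> simp [signPatterns]

theorem patternColour_allowed {z o : Bool} {p : ℕ} (hp : p ∈ signPatterns o) :
    colourAllowed z o p (patternColour z o p) = true := by
  have h := List.all_eq_true.1 (patternColour_check z o) p hp
  rw [Bool.and_eq_true] at h
  exact h.1

theorem bitCount_xor_le {z o : Bool} {p q : ℕ} (hp : p ∈ signPatterns o) (hq : q ∈ signPatterns o)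
    (hpq : patternColour z o p = patternColour z o q) (h8 : patternColour z o p < 8) :
    bitCount 8 (p ^^^ q) ≤ 4 := by
  have h := List.all_eq_true.1 (patternColour_check z o) p hp
  rw [Bool.and_eq_true] at h
  have h' := List.all_eq_true.1 h.2 q hq
  simp only [Bool.or_eq_true, bne_iff_ne, Nat.ble_eq, ne_eq] at h'
  omega

/-- The forbidden `g` are those whose place in the octad could be `0`, or could be `n` or beyond. -/
theorem colourAllowed_place {z o : Bool} {p g : ℕ} (h : colourAllowed z o p g = true)
    (hg : g < 8) :
    p.testBit g = true ∧ (z = true → g ≠ 0) ∧ (o = true → g ≠ 7) ∧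
      (o = false → p.testBit 6 = p.testBit 7 →
        g ≠ 7 ∧ (p.testBit 5 = p.testBit 6 → g ≠ 6)) := by
  rw [colourAllowed, if_pos hg] at h
  cases z <;> cases o <;> simp_all <;> grind

theorem colourAllowed_eight {z o : Bool} {p : ℕ} (h : colourAllowed z o p 8 = true) :
    p = 0 ∨ (z = true ∧ bitCount 8 p = 2 ∧ p.testBit 0 = true) := by
  simpa [colourAllowed, and_assoc] using h

theorem colourAllowed_nine {z o : Bool} {p g : ℕ} (h : colourAllowed z o p g = true)
    (h8 : 8 < g) :
    bitCount 8 p = 2 ∧ (z = true → p.testBit 0 = false ∧ p.testBit 1 = true) ∧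
      (z = false → p.testBit 0 = true) ∧ (o = true → p.testBit 7 = true) := by
  rw [colourAllowed, if_neg (by omega), if_neg (by simp; omega)] at h
  cases z <;> cases o <;> simp_all

/-! ### Octad vectors and pair vectors -/

open Finset

/-- The places below 24 at which `t` does not vanish. -/
def supp24 (t : ℕ → ℤ) : Finset ℕ := {i ∈ range 24 | t i ≠ 0}

/-- The places below 24 at which `t` takes the value 1. -/
def plus24 (t : ℕ → ℤ) : Finset ℕ := {i ∈ range 24 | t i = 1}

/-- The inner product of the first 24 coordinates. -/
def dot24 (t u : ℕ → ℤ) : ℤ := ∑ i ∈ range 24, t i * u i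

/-- Vectors with eight coordinates `±1`, evenly many of them 1, and zeros elsewhere. -/
structure IsOctadVector (t : ℕ → ℤ) : Prop where
  val : ∀ i, t i = -1 ∨ t i = 0 ∨ t i = 1
  zero : ∀ i, 24 ≤ i → t i = 0
  card : #(supp24 t) = 8
  even : #(plus24 t) % 2 = 0

/-- Vectors with two coordinates `±2` and zeros elsewhere. -/
def IsPairVector (t : ℕ → ℤ) : Prop :=
  ∃ a b, a < b ∧ b < 24 ∧ ∃ r s : ℤ, (r = 1 ∨ r = -1) ∧ (s = 1 ∨ s = -1) ∧
    ∀ i, t i = if i = a then 2 * r else if i = b then 2 * s else 0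

/-- The linear relations between the last coordinates of the vectors of the laminated lattice of
dimension `n`. In some dimensions (`o = true`) the last two or three coordinates have sum zero; in
the others `n` coordinates are free, and at most two more repeat the last one of these. -/
structure LastCoords (o : Bool) (n : ℕ) (t : ℕ → ℤ) : Prop where
  opposite : o = true → (∀ i, n < i → t i = 0) ∧
    (t n + t (n - 1) = 0 ∨ 2 ≤ n ∧ t n + t (n - 1) + t (n - 2) = 0)
  equal : o = false → 3 ≤ n ∧ (∀ i, n + 1 < i → t i = 0) ∧ (t n = 0 ∨ t n = t (n - 1)) ∧
    (t (n + 1) = 0 ∨ t (n + 1) = t n ∧ t n = t (n - 1))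

/-- The elements of an 8-element set in increasing order. -/
def enum8 (S : Finset ℕ) (k : Fin 8) : ℕ := if h : #S = 8 then S.orderEmbOfFin h k else 0

/-- The signs of `t` on its support as binary digits. -/
def signPattern (t : ℕ → ℤ) : ℕ :=
  Nat.ofBits fun k : Fin 8 => decide (t (enum8 (supp24 t) k) = 1)

theorem enum8_strictMono {S : Finset ℕ} (h : #S = 8) : StrictMono (enum8 S) := by
  intro i j hij
  simpa [enum8, h] using hij

theorem enum8_mem {S : Finset ℕ} (h : #S = 8) (k : Fin 8) : enum8 S k ∈ S := by
  simp [enum8, h]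

theorem exists_enum8_eq {S : Finset ℕ} (h : #S = 8) {i : ℕ} (hi : i ∈ S) :
    ∃ k, enum8 S k = i := by
  have := S.range_orderEmbOfFin h
  have hi' : i ∈ Set.range (S.orderEmbOfFin h) := by rw [this]; exact hi
  obtain ⟨k, hk⟩ := hi'
  exact ⟨k, by simpa [enum8, h] using hk⟩

theorem sum_enum8 {M : Type*} [AddCommMonoid M] {S : Finset ℕ} (h : #S = 8) (f : ℕ → M) :
    ∑ k, f (enum8 S k) = ∑ i ∈ S, f i := by
  refine Finset.sum_bij (fun k _ => enum8 S k) (fun k _ => enum8_mem h k)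
    (fun k _ l _ hkl => (enum8_strictMono h).injective hkl) (fun i hi => ?_) (fun _ _ => rfl)
  obtain ⟨k, hk⟩ := exists_enum8_eq h hi
  exact ⟨k, mem_univ _, hk⟩

theorem testBit_signPattern (t : ℕ → ℤ) (k : Fin 8) :
    (signPattern t).testBit k = decide (t (enum8 (supp24 t) k) = 1) := by
  simp [signPattern, Nat.testBit_ofBits_lt]

theorem signPattern_lt (t : ℕ → ℤ) : signPattern t < 256 := Nat.ofBits_lt_two_pow _

theorem dot24_comm (t u : ℕ → ℤ) : dot24 t u = dot24 u t := by
  simp [dot24, mul_comm]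

namespace IsOctadVector

variable {t u : ℕ → ℤ}

theorem mem_supp24 (ht : IsOctadVector t) {i : ℕ} : i ∈ supp24 t ↔ t i ≠ 0 := by
  simp only [supp24, mem_filter, mem_range, and_iff_right_iff_imp]
  intro h
  by_contra hi
  exact h (ht.zero i (by omega))

theorem mem_plus24 (ht : IsOctadVector t) {i : ℕ} : i ∈ plus24 t ↔ t i = 1 := by
  simp only [plus24, mem_filter, mem_range, and_iff_right_iff_imp]
  intro h
  by_contra hi
  have := ht.zero i (by omega)
  omega

theorem apply_enum8_ne (ht : IsOctadVector t) (k : Fin 8) : t (enum8 (supp24 t) k) ≠ 0 :=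
  ht.mem_supp24.1 (enum8_mem ht.card k)

theorem exists_enum8 (ht : IsOctadVector t) {i : ℕ} (hi : t i ≠ 0) :
    ∃ k, enum8 (supp24 t) k = i :=
  exists_enum8_eq ht.card (ht.mem_supp24.2 hi)

theorem bitCount_signPattern (ht : IsOctadVector t) :
    bitCount 8 (signPattern t) = #(plus24 t) := by
  rw [← sum_testBit_eq_bitCount]
  simp only [testBit_signPattern, decide_eq_true_eq]
  rw [sum_enum8 ht.card fun i => if t i = 1 then 1 else 0, ← Finset.card_filter]
  congr 1
  ext i
  rw [mem_filter, ht.mem_supp24, ht.mem_plus24]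
  constructor
  · exact fun h => h.2
  · intro h
    exact ⟨by omega, h⟩

/-- Each of the eight places contributes `1` if the signs agree and `-1` if not. -/
theorem dot24_of_supp24_eq (ht : IsOctadVector t) (hu : IsOctadVector u)
    (h : supp24 t = supp24 u) :
    dot24 t u = 8 - 2 * (bitCount 8 (signPattern t ^^^ signPattern u) : ℤ) := by
  have h1 : dot24 t u = ∑ i ∈ supp24 t, t i * u i := by
    refine (Finset.sum_subset (filter_subset _ _) fun i _ hi => ?_).symm
    have := mt ht.mem_supp24.2 hi
    rw [not_not] at this
    rw [this, zero_mul]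
  rw [h1, ← sum_enum8 ht.card, ← sum_testBit_eq_bitCount]
  push_cast
  rw [mul_sum]
  have h8 : (8 : ℤ) = ∑ _k : Fin 8, 1 := by simp
  rw [h8, ← sum_sub_distrib]
  refine sum_congr rfl fun k _ => ?_
  rw [Nat.testBit_xor, testBit_signPattern, testBit_signPattern, ← h]
  have h2 := ht.apply_enum8_ne k
  have h3 := hu.apply_enum8_ne k
  rw [← h] at h3
  rcases ht.val (enum8 (supp24 t) k) with h4 | h4 | h4 <;>
  rcases hu.val (enum8 (supp24 t) k) with h5 | h5 | h5 <;> simp_all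

/-- Of at most four common places one contributes `1`, the others at least `-1` each. -/
theorem neg_two_le_dot24 (ht : IsOctadVector t) (hu : IsOctadVector u)
    (h : #(supp24 t ∩ supp24 u) ≤ 4) {a : ℕ} (hta : t a = 1) (hua : u a = 1) :
    -2 ≤ dot24 t u := by
  have h1 : dot24 t u = ∑ i ∈ supp24 t ∩ supp24 u, t i * u i := by
    refine (Finset.sum_subset (fun i hi => ?_) fun i _ hi => ?_).symm
    · exact (mem_filter.1 (mem_inter.1 hi).1).1
    · rw [mem_inter, ht.mem_supp24, hu.mem_supp24] at hi
      rw [mul_eq_zero]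
      tauto
  have h2 : t a * u a + 1 ≤ ∑ i ∈ supp24 t ∩ supp24 u, (t i * u i + 1) := by
    refine single_le_sum (f := fun i => t i * u i + 1) (fun i _ => ?_) ?_
    · rcases ht.val i with h4 | h4 | h4 <;> rcases hu.val i with h5 | h5 | h5 <;> simp [h4, h5]
    · rw [mem_inter, ht.mem_supp24, hu.mem_supp24]
      omega
  rw [sum_add_distrib, ← h1, hta, hua] at h2
  simp only [sum_const, nsmul_eq_mul, mul_one] at h2
  omega

/-- Two octad vectors with at most two coordinates 1 each and inner product at most -4 have the
value -1 at each place where the other one has the value 1. -/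
theorem eq_neg_one_of_dot24_le (ht : IsOctadVector t) (hu : IsOctadVector u)
    (ht2 : #(plus24 t) ≤ 2) (hu2 : #(plus24 u) ≤ 2) (h : dot24 t u ≤ -4) :
    #(plus24 t) = 2 ∧ #(plus24 u) = 2 ∧ (∀ i, t i = 1 → u i = -1) ∧
      ∀ i, u i = 1 → t i = -1 := by
  -- Every term of `f` is nonnegative, and the total is at most `-4 + 2 + 2 = 0`. Hence all terms
  -- vanish and both counts are 2.
  set f : ℕ → ℤ := fun i => t i * u i + (if t i = 1 then 1 else 0) + (if u i = 1 then 1 else 0)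
    with hf
  have hf0 : ∀ i ∈ range 24, 0 ≤ f i := by
    intro i _
    rcases ht.val i with h4 | h4 | h4 <;> rcases hu.val i with h5 | h5 | h5 <;> simp [hf, h4, h5]
  have hsum : ∑ i ∈ range 24, f i = dot24 t u + #(plus24 t) + #(plus24 u) := by
    simp [hf, sum_add_distrib, dot24, plus24]
  have hnn := sum_nonneg hf0
  have hzero := (sum_eq_zero_iff_of_nonneg hf0).1 (by omega)
  refine ⟨by omega, by omega, fun i hi => ?_, fun i hi => ?_⟩
  · have h1 := hzero i (mem_filter.1 (ht.mem_plus24.2 hi)).1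
    rcases hu.val i with h5 | h5 | h5 <;> simp [hf, hi, h5] at h1 ⊢
  · have h1 := hzero i (mem_filter.1 (hu.mem_plus24.2 hi)).1
    rcases ht.val i with h5 | h5 | h5 <;> simp [hf, hi, h5] at h1 ⊢

end IsOctadVector

/-! ### Colouring the minimal vectors -/

open Classical in
/-- The colours of the minimal vectors of the laminated lattice of dimension `n`. A colour `a` with
`0 < a < n` is only given to vectors with `0 < t a`. -/
noncomputable def colour (o : Bool) (n : ℕ) (t : ℕ → ℤ) : ℕ :=
  if IsOctadVector t then
    let g := patternColour (decide (0 ∈ supp24 t))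
      (o && decide (n ∈ supp24 t ∨ n - 1 ∈ supp24 t)) (signPattern t)
    if h : g < 8 then enum8 (supp24 t) ⟨g, h⟩ else if g = 8 then 0 else n
  else if h : ∃ a, 0 < a ∧ a < n ∧ 0 < t a then h.choose
  else if t 0 < 0 ∨ 0 < t n then n
  else 0

/-- The octad vectors of colour 0 satisfy this. -/
def OctadLow (t : ℕ → ℤ) : Prop := #(plus24 t) = 0 ∨ #(plus24 t) = 2 ∧ t 0 = 1

/-- The octad vectors of colour `n` satisfy this. -/
def OctadHigh (o : Bool) (n : ℕ) (t : ℕ → ℤ) : Prop :=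
  #(plus24 t) = 2 ∧ t 0 ≠ 1 ∧ (o = true → 0 ≤ t n) ∧
    ∃ m, 0 < m ∧ t m = 1 ∧ ∀ i, 0 < i → t i ≠ 0 → m ≤ i

/-- The pair vectors of colour 0 satisfy this. -/
def PairLow (t : ℕ → ℤ) : Prop := 0 ≤ t 0 ∧ ∀ i, i ≠ 0 → t i ≤ 0

/-- The pair vectors of colour `n` satisfy this. -/
def PairHigh (o : Bool) (n : ℕ) (t : ℕ → ℤ) : Prop :=
  (∀ i, i ≠ n → t i ≤ 0) ∧ 0 ≤ t n ∧ (o = false → t n = 0) ∧ (t 0 < 0 ∨ 0 < t n)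

namespace IsOctadVector

variable {o : Bool} {n : ℕ} {t u : ℕ → ℤ}

theorem le_enum8 (ht : IsOctadVector t) {i : ℕ} (hi : t i ≠ 0) :
    (i = enum8 (supp24 t) 7 ∨ i = enum8 (supp24 t) 6 ∨ i ≤ enum8 (supp24 t) 5) ∧
      enum8 (supp24 t) 5 < enum8 (supp24 t) 6 ∧ enum8 (supp24 t) 6 < enum8 (supp24 t) 7 := by
  have hsm := enum8_strictMono ht.card
  refine ⟨?_, hsm (by decide), hsm (by decide)⟩
  obtain ⟨k, rfl⟩ := ht.exists_enum8 hi
  have hk : k = 7 ∨ k = 6 ∨ k ≤ 5 :=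
    (by decide : ∀ k : Fin 8, k = 7 ∨ k = 6 ∨ k ≤ 5) k
  rcases hk with rfl | rfl | hk
  · exact Or.inl rfl
  · exact Or.inr (Or.inl rfl)
  · exact Or.inr (Or.inr (hsm.monotone hk))

/-- If the sum of the last coordinates vanishes and one of them does not, then the last two places of
the octad are among them. -/
theorem last_opposite (ht : IsOctadVector t) (hl : LastCoords true n t)
    (h : n ∈ supp24 t ∨ n - 1 ∈ supp24 t) :
    t (enum8 (supp24 t) 6) + t (enum8 (supp24 t) 7) = 0 ∧ enum8 (supp24 t) 6 < n ∧
      enum8 (supp24 t) 7 ≤ n ∧ (t n ≠ 0 → enum8 (supp24 t) 7 = n) := by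
  rw [ht.mem_supp24, ht.mem_supp24] at h
  obtain ⟨hz, hsum⟩ := hl.opposite rfl
  have h7 := ht.apply_enum8_ne 7
  have h6 := ht.apply_enum8_ne 6
  have hle := fun i => ht.le_enum8 (i := i)
  generalize enum8 (supp24 t) 7 = e7 at *
  generalize enum8 (supp24 t) 6 = e6 at *
  generalize enum8 (supp24 t) 5 = e5 at *
  have h7n : e7 ≤ n := by
    by_contra hlt
    exact h7 (hz e7 (by omega))
  have h67 := (hle e7 h7).2
  -- Entries from `{-1, 0, 1}` with sum zero, not all zero: exactly two of the last two or three are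
  -- nonzero, and they are opposite.
  have key : (e7 = n ∧ e6 = n - 1 ∧ t n + t (n - 1) = 0 ∧ 1 ≤ n) ∨
      (2 ≤ n ∧ e7 = n ∧ e6 = n - 2 ∧ t n + t (n - 2) = 0) ∨
      (2 ≤ n ∧ e7 = n - 1 ∧ e6 = n - 2 ∧ t (n - 1) + t (n - 2) = 0 ∧ t n = 0) := by
    have hn0 := hle n
    have hn1 := hle (n - 1)
    have hn2 := hle (n - 2)
    have v0 := ht.val n
    have v1 := ht.val (n - 1)
    have v2 := ht.val (n - 2)
    rcases hsum with hsum | ⟨h2, hsum⟩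
    · have h0 : t n ≠ 0 := by omega
      have h1 : t (n - 1) ≠ 0 := by omega
      have := (hn0 h0).1
      have := (hn1 h1).1
      left
      refine ⟨by omega, ?_, hsum, by omega⟩
      omega
    · by_cases h0 : t n = 0
      · have h1 : t (n - 1) ≠ 0 := by omega
        have h2' : t (n - 2) ≠ 0 := by omega
        have := (hn1 h1).1
        have := (hn2 h2').1
        have : e7 ≠ n := by
          rintro rfl
          exact h7 h0
        omega
      · have := (hn0 h0).1
        by_cases h1 : t (n - 1) = 0
        · have h2' : t (n - 2) ≠ 0 := by omega
          have := (hn2 h2').1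
          have : e6 ≠ n - 1 := by
            rintro rfl
            exact h6 h1
          omega
        · have := (hn1 h1).1
          have : t (n - 2) = 0 := by
            by_contra h2'
            omega
          omega
  rcases key with ⟨rfl, rfl, h1, h2⟩ | ⟨h2, rfl, rfl, h1⟩ | ⟨h2, rfl, rfl, h1, h3⟩
  · exact ⟨by omega, by omega, le_rfl, fun _ => rfl⟩
  · exact ⟨by omega, by omega, le_rfl, fun _ => rfl⟩
  · exact ⟨by omega, by omega, by omega, fun h => absurd h3 h⟩

/-- The places of the octad that are not below `n`, if the last coordinates repeat an earlier one. -/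
theorem last_equal (ht : IsOctadVector t) (hl : LastCoords false n t) (k : Fin 8)
    (hk : n ≤ enum8 (supp24 t) k) :
    t (enum8 (supp24 t) 6) = t (enum8 (supp24 t) 7) ∧
      (k = 7 ∨ k = 6 ∧ t (enum8 (supp24 t) 5) = t (enum8 (supp24 t) 6)) := by
  obtain ⟨hn3, hz, hn, hn1⟩ := hl.equal rfl
  have hsm := enum8_strictMono ht.card
  have hk' : k = 7 ∨ k = 6 ∨ k ≤ 5 :=
    (by decide : ∀ k : Fin 8, k = 7 ∨ k = 6 ∨ k ≤ 5) k
  have h7 := ht.apply_enum8_ne 7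
  have h6 := ht.apply_enum8_ne 6
  have hle := fun i => ht.le_enum8 (i := i)
  have hk5 : k ≤ 5 → enum8 (supp24 t) k ≤ enum8 (supp24 t) 5 := fun h => hsm.monotone h
  have hk6 : k = 6 → enum8 (supp24 t) k = enum8 (supp24 t) 6 := fun h => by rw [h]
  have hk7 : k = 7 → enum8 (supp24 t) k = enum8 (supp24 t) 7 := fun h => by rw [h]
  generalize enum8 (supp24 t) k = ek at *
  generalize enum8 (supp24 t) 7 = e7 at *
  generalize enum8 (supp24 t) 6 = e6 at *
  generalize enum8 (supp24 t) 5 = e5 at *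
  have h7n : e7 ≤ n + 1 := by
    by_contra hlt
    exact h7 (hz e7 (by omega))
  have h67 := (hle e7 h7).2
  -- The octad ends with either two or three equal entries, beginning at place `n - 1`.
  by_cases h1 : t (n + 1) = 0
  · have h7n' : e7 ≠ n + 1 := by
      rintro rfl
      exact h7 h1
    have hk7' : k = 7 := by
      rcases hk' with h | h | h
      · exact h
      · have := hk6 h
        omega
      · have := hk5 h
        omega
    have := hk7 hk7'
    have e7n : e7 = n := by omega
    have h3 : t (n - 1) ≠ 0 := by
      rw [e7n] at h7
      omega
    have := (hle _ h3).1
    have e6n : e6 = n - 1 := by omega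
    rw [e7n, e6n]
    rw [e7n] at h7
    exact ⟨by omega, Or.inl hk7'⟩
  · have h2 : t n ≠ 0 := by omega
    have h3 : t (n - 1) ≠ 0 := by omega
    have := (hle _ h1).1
    have := (hle _ h2).1
    have := (hle _ h3).1
    have e7n : e7 = n + 1 := by omega
    have e6n : e6 = n := by omega
    have e5n : e5 = n - 1 := by omega
    rw [e7n, e6n, e5n]
    refine ⟨by omega, ?_⟩
    rcases hk' with h | h | h
    · exact Or.inl h
    · exact Or.inr ⟨h, by omega⟩
    · have := hk5 h
      omega

theorem last_lt (ht : IsOctadVector t) (hl : LastCoords true n t)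
    (h : ¬ (n ∈ supp24 t ∨ n - 1 ∈ supp24 t)) (k : Fin 8) : enum8 (supp24 t) k < n := by
  by_contra hk
  rw [ht.mem_supp24, ht.mem_supp24] at h
  have h1 := ht.apply_enum8_ne k
  rcases (not_lt.1 hk).eq_or_lt with h2 | h2
  · exact h (Or.inl (h2 ▸ h1))
  · exact h1 ((hl.opposite rfl).1 _ h2)

theorem signPattern_mem (ht : IsOctadVector t) (hl : LastCoords o n t) :
    signPattern t ∈ signPatterns (o && decide (n ∈ supp24 t ∨ n - 1 ∈ supp24 t)) := by
  rw [mem_signPatterns]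
  refine ⟨signPattern_lt t, by rw [ht.bitCount_signPattern]; exact ht.even, fun h => ?_⟩
  rw [Bool.and_eq_true, decide_eq_true_eq] at h
  obtain ⟨rfl, h⟩ := h
  have h1 := (ht.last_opposite hl h).1
  have h6 := testBit_signPattern t 6
  have h7 := testBit_signPattern t 7
  simp only [Fin.isValue, Fin.coe_ofNat_eq_mod, Nat.reduceMod] at h6 h7
  rw [h6, h7]
  rcases ht.val (enum8 (supp24 t) 6) with h2 | h2 | h2
  · simp [h2]; omega
  · exact absurd h2 (ht.apply_enum8_ne 6)
  · simp [h2]; omega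

/-- The restrictions in `colourAllowed` are translated into places. A table colour below 8 names a
place strictly between `0` and `n`: `last_opposite`, `last_lt` and `last_equal` show that the
excluded digits cover all places from `n` on. The table colours 8 and 9 become `0` and `n`. -/
theorem colour_cases (ht : IsOctadVector t) (hl : LastCoords o n t) :
    (0 < colour o n t ∧ colour o n t < n ∧ t (colour o n t) = 1 ∧
      ∃ h : patternColour (decide (0 ∈ supp24 t))
          (o && decide (n ∈ supp24 t ∨ n - 1 ∈ supp24 t)) (signPattern t) < 8,
        colour o n t = enum8 (supp24 t) ⟨_, h⟩) ∨
    colour o n t = 0 ∧ OctadLow t ∨ colour o n t = n ∧ OctadHigh o n t := by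
  have hp := ht.signPattern_mem hl
  set z := decide (0 ∈ supp24 t) with hz
  set o' := o && decide (n ∈ supp24 t ∨ n - 1 ∈ supp24 t) with ho'
  have hc := patternColour_allowed (z := z) hp
  have hbit := testBit_signPattern t
  have hsm := enum8_strictMono ht.card
  have hz0 : z = true → enum8 (supp24 t) 0 = 0 := by
    intro h
    rw [hz, decide_eq_true_eq] at h
    obtain ⟨k, hk⟩ := exists_enum8_eq ht.card h
    have := hsm.monotone (Fin.zero_le k)
    omega
  have hz1 : z = false → t 0 = 0 := by
    intro h
    rw [hz, decide_eq_false_iff_not, ht.mem_supp24, not_not] at h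
    exact h
  by_cases h8 : patternColour z o' (signPattern t) < 8
  · left
    set g : Fin 8 := ⟨patternColour z o' (signPattern t), h8⟩ with hg
    have hcol : colour o n t = enum8 (supp24 t) g := by
      rw [colour, if_pos ht]
      exact dif_pos h8
    obtain ⟨h1, h2, h3, h4⟩ := colourAllowed_place hc h8
    have hgbit := hbit g
    rw [show ((g : ℕ)) = patternColour z o' (signPattern t) from rfl, h1] at hgbit
    rw [hcol]
    refine ⟨?_, ?_, ?_, h8, rfl⟩
    · rw [Nat.pos_iff_ne_zero]
      intro h0
      have hz' : z = true := by
        rw [hz, decide_eq_true_eq, ← h0]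
        exact enum8_mem ht.card g
      have : g = 0 := hsm.injective (by rw [h0, hz0 hz'])
      exact h2 hz' (by rw [Fin.ext_iff] at this; exact this)
    · cases o with
      | true =>
        by_cases h : n ∈ supp24 t ∨ n - 1 ∈ supp24 t
        · have h7 : (g : ℕ) ≠ 7 := h3 (by simp [ho', h])
          have : g ≤ 6 := by
            rw [Fin.le_def]
            have := g.2
            simp only [Fin.isValue, Fin.coe_ofNat_eq_mod, Nat.reduceMod]
            omega
          exact (hsm.monotone this).trans_lt (ht.last_opposite hl h).2.1
        · exact ht.last_lt hl h g
      | false =>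
        by_contra hlt
        obtain ⟨h5, h6⟩ := ht.last_equal hl g (not_lt.1 hlt)
        have hb5 := hbit 5
        have hb6 := hbit 6
        have hb7 := hbit 7
        simp only [Fin.isValue, Fin.coe_ofNat_eq_mod, Nat.reduceMod] at hb5 hb6 hb7
        obtain ⟨h9, h10⟩ := h4 (by simp [ho']) (by rw [hb6, hb7, h5])
        rcases h6 with h6 | ⟨h6, h6'⟩
        · exact h9 (by rw [Fin.ext_iff] at h6; exact h6)
        · exact h10 (by rw [hb5, hb6, h6']) (by rw [Fin.ext_iff] at h6; exact h6)
    · simpa using hgbit.symm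
  · right
    have hb0 := hbit 0
    have hb1 := hbit 1
    have hb7 := hbit 7
    simp only [Fin.isValue, Fin.coe_ofNat_eq_mod, Nat.reduceMod, Nat.zero_mod] at hb0 hb1 hb7
    have hcol : colour o n t = if patternColour z o' (signPattern t) = 8 then 0 else n := by
      rw [colour, if_pos ht]
      exact dif_neg h8
    by_cases h88 : patternColour z o' (signPattern t) = 8
    · left
      rw [hcol, if_pos h88]
      refine ⟨rfl, ?_⟩
      rw [h88] at hc
      rcases colourAllowed_eight hc with h | ⟨h1, h2, h3⟩
      · left
        rw [← ht.bitCount_signPattern, h]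
        rfl
      · right
        rw [← ht.bitCount_signPattern]
        refine ⟨h2, ?_⟩
        rw [hb0, decide_eq_true_eq, hz0 h1] at h3
        exact h3
    · right
      rw [hcol, if_neg h88]
      refine ⟨rfl, ?_⟩
      obtain ⟨h1, h2, h3, h4⟩ := colourAllowed_nine hc (by omega)
      rw [ht.bitCount_signPattern] at h1
      replace h2 : z = true → t (enum8 (supp24 t) 0) ≠ 1 ∧ t (enum8 (supp24 t) 1) = 1 :=
        fun h => by simpa only [hb0, hb1, decide_eq_true_eq, decide_eq_false_iff_not] using h2 h
      replace h3 : z = false → t (enum8 (supp24 t) 0) = 1 :=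
        fun h => by simpa only [hb0, decide_eq_true_eq] using h3 h
      replace h4 : o' = true → t (enum8 (supp24 t) 7) = 1 :=
        fun h => by simpa only [hb7, decide_eq_true_eq] using h4 h
      refine ⟨h1, ?_, ?_, ?_⟩
      · rcases Bool.eq_false_or_eq_true z with h | h
        · rw [← hz0 h]
          exact (h2 h).1
        · rw [hz1 h]
          norm_num
      · rintro rfl
        by_cases h0 : t n = 0
        · exact h0.ge
        · have h : n ∈ supp24 t ∨ n - 1 ∈ supp24 t := Or.inl (ht.mem_supp24.2 h0)
          rw [← (ht.last_opposite hl h).2.2.2 h0, h4 (by simp [ho', h])]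
          norm_num
      -- The first place of the octad other than `0` is its second element if it contains `0`,
      -- otherwise its first.
      · rcases Bool.eq_false_or_eq_true z with h | h
        · refine ⟨enum8 (supp24 t) 1, ?_, (h2 h).2, fun i hi hti => ?_⟩
          · rw [← hz0 h]
            exact hsm (by decide)
          · obtain ⟨k, rfl⟩ := ht.exists_enum8 hti
            refine hsm.monotone ?_
            rw [Fin.le_def]
            by_contra hk
            have : k = 0 := by
              rw [Fin.ext_iff]
              simp at hk ⊢
              omega
            rw [this, hz0 h] at hi
            exact lt_irrefl _ hi
        · refine ⟨enum8 (supp24 t) 0, ?_, h3 h, fun i hi hti => ?_⟩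
          · rw [Nat.pos_iff_ne_zero]
            intro h0
            have := h3 h
            rw [h0, hz1 h] at this
            norm_num at this
          · obtain ⟨k, rfl⟩ := ht.exists_enum8 hti
            exact hsm.monotone (Fin.zero_le k)

end IsOctadVector

namespace IsPairVector

variable {o : Bool} {n : ℕ} {t u : ℕ → ℤ}

theorem dot24_eq (ht : IsPairVector t) : ∃ a b, a < b ∧ b < 24 ∧ (t a = 2 ∨ t a = -2) ∧
    (t b = 2 ∨ t b = -2) ∧ (∀ i, i ≠ a → i ≠ b → t i = 0) ∧
    ∀ u, dot24 t u = t a * u a + t b * u b := by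
  obtain ⟨a, b, hab, hb, r, s, hr, hs, h⟩ := ht
  refine ⟨a, b, hab, hb, ?_, ?_, ?_, fun u => ?_⟩
  · rw [h a, if_pos rfl]
    omega
  · rw [h b, if_neg (by omega), if_pos rfl]
    omega
  · intro i hia hib
    rw [h i, if_neg hia, if_neg hib]
  · rw [dot24, ← Finset.sum_subset (s₁ := {a, b})]
    · rw [Finset.sum_pair hab.ne]
    · intro i hi
      simp only [mem_insert, mem_singleton] at hi
      rw [mem_range]
      omega
    · intro i _ hi
      simp only [mem_insert, mem_singleton, not_or] at hi
      rw [h i, if_neg hi.1, if_neg hi.2, zero_mul]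

theorem not_isOctadVector (ht : IsPairVector t) : ¬ IsOctadVector t := by
  intro h
  obtain ⟨a, b, -, -, ha, -⟩ := ht.dot24_eq
  have := h.val a
  omega

theorem colour_cases (ht : IsPairVector t) (hl : LastCoords o n t) (hn : 1 ≤ n) :
    (0 < colour o n t ∧ colour o n t < n ∧ 0 < t (colour o n t)) ∨
    colour o n t = 0 ∧ PairLow t ∨ colour o n t = n ∧ PairHigh o n t := by
  by_cases h : ∃ a, 0 < a ∧ a < n ∧ 0 < t a
  · left
    rw [colour, if_neg ht.not_isOctadVector, dif_pos h]
    exact h.choose_spec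
  · right
    have hc : colour o n t = if t 0 < 0 ∨ 0 < t n then n else 0 := by
      rw [colour, if_neg ht.not_isOctadVector, dif_neg h]
    push Not at h
    by_cases h' : t 0 < 0 ∨ 0 < t n
    · right
      rw [hc, if_pos h']
      refine ⟨rfl, ?_⟩
      obtain ⟨a, b, hab, hb, hta, htb, hz, -⟩ := ht.dot24_eq
      cases o with
      | true =>
        obtain ⟨h1, h2⟩ := hl.opposite rfl
        have h0 : t 0 ≤ 0 ∧ 0 ≤ t n := by
          have z0 := hz 0
          have zn := hz n
          have z1 := hz (n - 1)
          have z2 := hz (n - 2)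
          have le1 := h (n - 1)
          have le2 := h (n - 2)
          -- For `n = 1` and `n = 2` the last places may include `0`, about which `h` says nothing.
          rcases (show n = 1 ∨ n = 2 ∨ 3 ≤ n by omega) with rfl | rfl | hn3
          · simp only [Nat.sub_self] at h2
            omega
          · simp only [Nat.sub_self, Nat.add_one_sub_one] at h2 le1 le2 z1 z2
            omega
          · omega
        refine ⟨fun i hi => ?_, h0.2, by simp, h'⟩
        rcases Nat.lt_or_ge i n with hin | hin
        · rcases Nat.eq_zero_or_pos i with rfl | hi0
          · exact h0.1
          · exact h i hi0 hin
        · exact (h1 i (by omega)).le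
      | false =>
        obtain ⟨h1, h2, h3, h4⟩ := hl.equal rfl
        have h5 := h (n - 1) (by omega) (by omega)
        have h6 : t 0 < 0 := by omega
        -- Otherwise `t n = t (n - 1)`, and with `t 0` there would be three nonzero entries.
        have h7 : t n = 0 := by
          by_contra h8
          have := hz 0
          have := hz n
          have := hz (n - 1)
          omega
        refine ⟨fun i hi => ?_, h7.ge, fun _ => h7, h'⟩
        rcases Nat.lt_or_ge i n with hin | hin
        · rcases Nat.eq_zero_or_pos i with rfl | hi0
          · exact h6.le
          · exact h i hi0 hin
        · rcases (show i = n + 1 ∨ n + 1 < i by omega) with rfl | hi'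
          · omega
          · exact (h2 i hi').le
    · left
      rw [hc, if_neg h']
      refine ⟨rfl, by omega, fun i hi => ?_⟩
      rcases Nat.lt_or_ge i n with hin | hin
      · exact h i (by omega) hin
      · cases o with
        | true =>
          rcases hin.eq_or_lt with rfl | hin
          · omega
          · exact ((hl.opposite rfl).1 i hin).le
        | false =>
          obtain ⟨h1, h2, h3, h4⟩ := hl.equal rfl
          rcases (show i = n ∨ i = n + 1 ∨ n + 1 < i by omega) with rfl | rfl | hi'
          · omega
          · omega
          · exact (h2 i hi').le

end IsPairVector

/-! ### Inner products within a colour -/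

section SameColour

variable {o : Bool} {n : ℕ} {t u : ℕ → ℤ}

/-- At `c` the pair vector has the entry 2 and `u` has its largest possible entry, so the other
place of the pair can at most cancel this contribution. -/
theorem neg_three_le_dot24_pair_of_pos (ht : IsPairVector t)
    (hu : IsPairVector u ∨ IsOctadVector u) {c : ℕ} (htc : 0 < t c) (huc : 0 < u c) :
    -3 ≤ dot24 t u := by
  obtain ⟨a, b, hab, hb, hta, htb, hz, hdot⟩ := ht.dot24_eq
  rw [hdot]
  have hc : c = a ∨ c = b := by
    by_contra hc
    have := hz c (by tauto) (by tauto)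
    omega
  have huv : (∀ i, u i = -2 ∨ u i = 0 ∨ u i = 2) ∨ (∀ i, u i = -1 ∨ u i = 0 ∨ u i = 1) := by
    rcases hu with hu | hu
    · obtain ⟨a', b', -, -, ha', hb', hz', -⟩ := hu.dot24_eq
      refine Or.inl fun i => ?_
      by_cases h1 : i = a'
      · subst h1; omega
      by_cases h2 : i = b'
      · subst h2; omega
      have := hz' i h1 h2
      omega
    · exact Or.inr hu.val
  have h1 : (u a = -2 ∨ u a = 0 ∨ u a = 2) ∧ (u b = -2 ∨ u b = 0 ∨ u b = 2) ∨
      (u a = -1 ∨ u a = 0 ∨ u a = 1) ∧ (u b = -1 ∨ u b = 0 ∨ u b = 1) :=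
    huv.imp (fun h => ⟨h a, h b⟩) (fun h => ⟨h a, h b⟩)
  rcases hc with rfl | rfl
  · have : t c = 2 := by omega
    rcases htb with htb | htb <;> rw [this, htb] <;> omega
  · have : t c = 2 := by omega
    rcases hta with hta | hta <;> rw [this, hta] <;> omega

theorem IsOctadVector.eq_of_card_plus24 (hu : IsOctadVector u) (h2 : #(plus24 u) = 2) {i j k : ℕ}
    (hi : u i = 1) (hj : u j = 1) (hk : u k = 1) : i = j ∨ i = k ∨ j = k := by
  by_contra h
  push Not at h
  have hsub : ({i, j, k} : Finset ℕ) ⊆ plus24 u := by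
    intro x hx
    simp only [mem_insert, mem_singleton] at hx
    rw [hu.mem_plus24]
    rcases hx with rfl | rfl | rfl <;> assumption
  have := card_le_card hsub
  rw [card_eq_three.2 ⟨i, j, k, h.1, h.2.1, h.2.2, rfl⟩] at this
  omega

/-- A product of `-4` would need either `u 0 = -1` together with an entry `1`, or two entries `1`
away from place `0`; `OctadLow` excludes both. -/
theorem neg_three_le_dot24_pairLow_octadLow (ht : IsPairVector t) (hu : IsOctadVector u)
    (htl : PairLow t) (hul : OctadLow u) : -3 ≤ dot24 t u := by
  obtain ⟨a, b, hab, hb, hta, htb, hz, hdot⟩ := ht.dot24_eq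
  rw [hdot]
  have htb' : t b = -2 := by
    have := htl.2 b (by omega)
    omega
  have va := hu.val a
  have vb := hu.val b
  have hplus : (∀ i, u i ≠ 1) ∨ u 0 = 1 := by
    refine hul.imp (fun h i hi => ?_) (fun h => h.2)
    rw [card_eq_zero] at h
    have := hu.mem_plus24.2 hi
    rw [h] at this
    exact notMem_empty _ this
  by_cases ha0 : a = 0
  · subst ha0
    have hta' : t 0 = 2 := by
      have := htl.1
      omega
    rw [hta', htb']
    rcases hplus with h | h
    · have := h b
      omega
    · omega
  · have hta' : t a = -2 := by
      have := htl.2 a ha0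
      omega
    rw [hta', htb']
    rcases hul with h | ⟨h, h0⟩
    · rw [card_eq_zero] at h
      have h1 : u a ≠ 1 := fun hi => by
        have := hu.mem_plus24.2 hi
        rw [h] at this
        exact notMem_empty _ this
      omega
    · by_contra hlt
      have h1 : u a = 1 := by omega
      have h2 : u b = 1 := by omega
      have := hu.eq_of_card_plus24 h h0 h1 h2
      omega

theorem neg_three_le_dot24_pairHigh_octadHigh (ht : IsPairVector t) (hu : IsOctadVector u)
    (hn : 1 ≤ n) (hth : PairHigh o n t) (huh : OctadHigh o n u) : -3 ≤ dot24 t u := by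
  obtain ⟨a, b, hab, hb, hta, htb, hz, hdot⟩ := ht.dot24_eq
  rw [hdot]
  obtain ⟨h1, h2, h3, h4⟩ := hth
  obtain ⟨-, h6, h7, -⟩ := huh
  have va := hu.val a
  have vb := hu.val b
  rcases h4 with h4 | h4
  · have ha : a = 0 := by
      by_contra ha
      have := hz 0 (by omega) (by omega)
      omega
    subst ha
    rcases hta with hta | hta <;> rcases htb with htb | htb <;> rw [hta, htb] <;> omega
  · have ho : o = true := by
      by_contra ho
      have := h3 (by simpa using ho)
      omega
    have hun := h7 ho
    by_cases han : a = n
    · subst han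
      rcases hta with hta | hta <;> rcases htb with htb | htb <;> rw [hta, htb] <;> omega
    · have hbn : b = n := by
        by_contra hbn
        have := hz n (by omega) (by omega)
        omega
      subst hbn
      have := h1 a han
      rcases hta with hta | hta <;> rcases htb with htb | htb <;> rw [hta, htb] <;> omega

/-- With product at most `-4` both vectors would have an entry `1` at place `0`, where they should
be opposite. -/
theorem neg_three_le_dot24_octadLow (ht : IsOctadVector t) (hu : IsOctadVector u)
    (htl : OctadLow t) (hul : OctadLow u) : -3 ≤ dot24 t u := by
  by_contra hlt
  obtain ⟨h1, h2, h3, -⟩ := ht.eq_neg_one_of_dot24_le hu (by unfold OctadLow at htl; omega)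
    (by unfold OctadLow at hul; omega) (by omega)
  have h4 : t 0 = 1 := by unfold OctadLow at htl; omega
  have h5 : u 0 = 1 := by unfold OctadLow at hul; omega
  have := h3 0 h4
  omega

/-- With product at most `-4`, the first positive place of either support, which carries `1`, lies
in the other support too. By minimality the two places coincide, yet the signs there should be
opposite. -/
theorem neg_three_le_dot24_octadHigh (ht : IsOctadVector t) (hu : IsOctadVector u)
    (hth : OctadHigh o n t) (huh : OctadHigh o n u) : -3 ≤ dot24 t u := by
  by_contra hlt
  obtain ⟨ht2, -, -, m, hm, htm, hmin⟩ := hth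
  obtain ⟨hu2, -, -, m', hm', hum, hmin'⟩ := huh
  obtain ⟨-, -, h3, h4⟩ := ht.eq_neg_one_of_dot24_le hu ht2.le hu2.le (by omega)
  have h5 := h3 m htm
  have h6 := h4 m' hum
  have h7 := hmin' m hm (by omega)
  have h8 := hmin m' hm' (by omega)
  have : m = m' := by omega
  subst this
  omega

/-- Minimal vectors of the same colour have inner product greater than -4. -/
theorem neg_three_le_dot24_of_colour_eq (hn : 1 ≤ n)
    (ht : IsPairVector t ∨ IsOctadVector t) (hu : IsPairVector u ∨ IsOctadVector u)
    (hlt : LastCoords o n t) (hlu : LastCoords o n u)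
    (hinter : IsOctadVector t → IsOctadVector u → supp24 t ≠ supp24 u →
      #(supp24 t ∩ supp24 u) ≤ 4)
    (hc : colour o n t = colour o n u) : -3 ≤ dot24 t u := by
  have hnonneg : ∀ t u : ℕ → ℤ, (∀ i, 0 ≤ t i * u i) → -3 ≤ dot24 t u := fun t u h =>
    le_trans (by norm_num) (sum_nonneg fun i _ => h i)
  rcases ht with ht | ht <;> rcases hu with hu | hu
  · rcases ht.colour_cases hlt hn with ⟨h1, h2, h3⟩ | ⟨h1, h2⟩ | ⟨h1, h2⟩ <;>
    rcases hu.colour_cases hlu hn with ⟨h4, h5, h6⟩ | ⟨h4, h5⟩ | ⟨h4, h5⟩ <;> try omega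
    · exact neg_three_le_dot24_pair_of_pos ht (Or.inl hu) h3 (hc ▸ h6)
    · refine hnonneg t u fun i => ?_
      by_cases hi : i = 0
      · subst hi
        exact mul_nonneg h2.1 h5.1
      · exact mul_nonneg_of_nonpos_of_nonpos (h2.2 i hi) (h5.2 i hi)
    · refine hnonneg t u fun i => ?_
      by_cases hi : i = n
      · subst hi
        exact mul_nonneg h2.2.1 h5.2.1
      · exact mul_nonneg_of_nonpos_of_nonpos (h2.1 i hi) (h5.1 i hi)
  · rcases ht.colour_cases hlt hn with ⟨h1, h2, h3⟩ | ⟨h1, h2⟩ | ⟨h1, h2⟩ <;>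
    rcases hu.colour_cases hlu with ⟨h4, h5, h6, -⟩ | ⟨h4, h5⟩ | ⟨h4, h5⟩ <;> try omega
    · exact neg_three_le_dot24_pair_of_pos ht (Or.inr hu) h3 (by rw [hc, h6]; norm_num)
    · exact neg_three_le_dot24_pairLow_octadLow ht hu h2 h5
    · exact neg_three_le_dot24_pairHigh_octadHigh ht hu hn h2 h5
  · rw [dot24_comm]
    rcases ht.colour_cases hlt with ⟨h1, h2, h3, -⟩ | ⟨h1, h2⟩ | ⟨h1, h2⟩ <;>
    rcases hu.colour_cases hlu hn with ⟨h4, h5, h6⟩ | ⟨h4, h5⟩ | ⟨h4, h5⟩ <;> try omega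
    · exact neg_three_le_dot24_pair_of_pos hu (Or.inr ht) h6 (by rw [← hc, h3]; norm_num)
    · exact neg_three_le_dot24_pairLow_octadLow hu ht h5 h2
    · exact neg_three_le_dot24_pairHigh_octadHigh hu ht hn h5 h2
  · rcases ht.colour_cases hlt with ⟨h1, h2, h3, h4, h5⟩ | ⟨h1, h2⟩ | ⟨h1, h2⟩ <;>
    rcases hu.colour_cases hlu with ⟨h6, h7, h8, h9, h10⟩ | ⟨h6, h7⟩ | ⟨h6, h7⟩ <;> try omega
    · by_cases hs : supp24 t = supp24 u
      · have hp := ht.signPattern_mem hlt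
        have hq := hu.signPattern_mem hlu
        rw [h5, h10] at hc
        simp only [← hs] at hc hq h9
        have := (enum8_strictMono ht.card).injective hc
        rw [Fin.mk.injEq] at this
        have := bitCount_xor_le hp hq this h4
        rw [ht.dot24_of_supp24_eq hu hs]
        omega
      · have := ht.neg_two_le_dot24 hu (hinter ht hu hs) h3 (hc ▸ h8)
        omega
    · exact neg_three_le_dot24_octadLow ht hu h2 h7
    · exact neg_three_le_dot24_octadHigh ht hu h2 h7

theorem colour_le (hn : 1 ≤ n) (ht : IsPairVector t ∨ IsOctadVector t) (hl : LastCoords o n t) :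
    colour o n t ≤ n := by
  rcases ht with ht | ht
  · rcases ht.colour_cases hl hn with h | h | h <;> omega
  · rcases ht.colour_cases hl with h | h | h <;> omega

end SameColour

/-! ### Halved vectors of the Leech lattice -/

/-- The halves of the vectors of the Leech lattice with even coordinates. -/
structure IsHalfLeech (z : Fin 24 → ℤ) : Prop where
  word : (fun i => (z i : ZMod 2)) ∈ golayCode
  sum : 4 ∣ ∑ i, z i

namespace IsHalfLeech

variable {z w : Fin 24 → ℤ}

theorem add (hz : IsHalfLeech z) (hw : IsHalfLeech w) : IsHalfLeech (z + w) := by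
  refine ⟨?_, ?_⟩
  · have := golayCode.add_mem hz.word hw.word
    convert this using 1
    funext i
    simp
  · simp only [Pi.add_apply, sum_add_distrib]
    exact dvd_add hz.sum hw.sum

/-- The sum counts the odd coordinates, that is, the weight of a nonzero Golay word. -/
theorem eight_le_sum_emod (hz : IsHalfLeech z) {j : Fin 24} (hj : z j % 2 ≠ 0) :
    8 ≤ ∑ i, z i % 2 := by
  have h := (golay_weight hz.word).2 (fun h0 => hj ?_)
  · have h2 : ∑ i, z i % 2 = ((∑ i, ((z i : ZMod 2)).val : ℕ) : ℤ) := by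
      push_cast
      exact sum_congr rfl fun i _ => (ZMod.val_intCast (z i)).symm
    rw [h2]
    exact_mod_cast h
  · have := congrFun h0 j
    simp only [Pi.zero_apply] at this
    rw [ZMod.intCast_zmod_eq_zero_iff_dvd] at this
    omega

theorem emod_two_le_sq (a : ℤ) : a % 2 ≤ a ^ 2 := by
  rcases Int.emod_two_eq_zero_or_one a with h | h
  · rw [h]
    positivity
  · rw [h]
    have : a ≠ 0 := by rintro rfl; simp at h
    have := sq_pos_of_ne_zero this
    omega

/-- With an odd coordinate there are at least eight of them. Otherwise `z = 2 v` with `∑ v i` even,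
so `∑ v i ^ 2` is even and positive, hence at least 2. -/
theorem eight_le_sum_sq (hz : IsHalfLeech z) (h0 : z ≠ 0) : 8 ≤ ∑ i, z i ^ 2 := by
  by_cases h : ∃ j, z j % 2 ≠ 0
  · obtain ⟨j, hj⟩ := h
    exact (hz.eight_le_sum_emod hj).trans (sum_le_sum fun i _ => emod_two_le_sq _)
  · push Not at h
    have h1 : ∀ i, ∃ v, z i = 2 * v := fun i => ⟨z i / 2, by have := h i; omega⟩
    choose v hv using h1
    have hs : 2 ∣ ∑ i, v i := by
      have := hz.sum
      simp only [hv, ← mul_sum] at this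
      omega
    have hv2 : ∑ i, z i ^ 2 = 4 * ∑ i, v i ^ 2 := by
      rw [mul_sum]
      refine sum_congr rfl fun i _ => ?_
      rw [hv]
      ring
    have hpar : 2 ∣ ∑ i, v i ^ 2 := by
      have h3 : 2 ∣ ∑ i, (v i ^ 2 - v i) := by
        refine dvd_sum fun i _ => ?_
        have : v i ^ 2 - v i = (v i - 1) * (v i - 1 + 1) := by ring
        rw [this]
        exact (Int.even_mul_succ_self _).two_dvd
      rw [sum_sub_distrib] at h3
      omega
    have hpos : 0 < ∑ i, v i ^ 2 := by
      obtain ⟨j, hj⟩ := Function.ne_iff.1 h0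
      have hvj : v j ≠ 0 := by
        intro h
        exact hj (by rw [hv, h]; rfl)
      exact (sq_pos_of_ne_zero hvj).trans_le
        (single_le_sum (f := fun i => v i ^ 2) (fun i _ => sq_nonneg _) (mem_univ j))
    omega

end IsHalfLeech

/-- The coordinate that stands at place `k`, counted from 0, in the order of `coordOrder`. -/
def coordPlace (k : ℕ) : Fin 24 := Fin.ofNat 24 (coordOrder.getD k 1 - 1)

/-- The coordinates of `z` in the order of `coordOrder`, followed by zeros. -/
def reorder (z : Fin 24 → ℤ) (k : ℕ) : ℤ := if k < 24 then z (coordPlace k) else 0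

theorem sum_coordPlace {M : Type*} [AddCommMonoid M] (f : Fin 24 → M) :
    ∑ k ∈ range 24, f (coordPlace k) = ∑ i, f i := by
  rw [Finset.sum_range]
  have hb : Function.Bijective fun k : Fin 24 => coordPlace k := by
    rw [Fintype.bijective_iff_injective_and_card]
    refine ⟨?_, rfl⟩
    decide +kernel
  exact hb.sum_comp f

theorem sum_reorder {M : Type*} [AddCommMonoid M] (f : ℤ → M) (z : Fin 24 → ℤ) :
    ∑ k ∈ range 24, f (reorder z k) = ∑ i, f (z i) := by
  rw [← sum_coordPlace]
  refine sum_congr rfl fun k hk => ?_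
  rw [reorder, if_pos (mem_range.1 hk)]

theorem dot24_reorder (z w : Fin 24 → ℤ) : dot24 (reorder z) (reorder w) = ∑ i, z i * w i := by
  rw [← sum_coordPlace]
  refine sum_congr rfl fun k hk => ?_
  rw [reorder, reorder, if_pos (mem_range.1 hk), if_pos (mem_range.1 hk)]

theorem reorder_eq_zero {z : Fin 24 → ℤ} {k : ℕ} (hk : 24 ≤ k) : reorder z k = 0 :=
  if_neg (by omega)

theorem isPairVector_of_sum_sq {t v : ℕ → ℤ} (htv : ∀ k, t k = 2 * v k)
    (hv : ∀ k, 24 ≤ k → v k = 0) (h : ∑ k ∈ range 24, v k ^ 2 = 2) : IsPairVector t := by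
  have hval : ∀ k, v k = -1 ∨ v k = 0 ∨ v k = 1 := by
    intro k
    by_cases hk : k < 24
    · have : v k ^ 2 ≤ 2 := h ▸ single_le_sum (f := fun i => v i ^ 2) (fun i _ => sq_nonneg _)
        (mem_range.2 hk)
      have h1 : v k < 2 := by nlinarith
      have h2 : -2 < v k := by nlinarith
      omega
    · exact Or.inr (Or.inl (hv k (by omega)))
  have hcard : #{k ∈ range 24 | v k ≠ 0} = 2 := by
    have : ((#{k ∈ range 24 | v k ≠ 0} : ℕ) : ℤ) = ∑ k ∈ range 24, v k ^ 2 := by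
      rw [card_filter]
      push_cast
      refine sum_congr rfl fun k _ => ?_
      rcases hval k with h | h | h <;> simp [h]
    omega
  obtain ⟨a, b, hab, hS⟩ := card_eq_two.1 hcard
  have hmem : ∀ k, v k ≠ 0 ↔ k = a ∨ k = b := by
    intro k
    have : k ∈ ({k ∈ range 24 | v k ≠ 0} : Finset ℕ) ↔ k = a ∨ k = b := by
      rw [hS]
      simp
    rw [← this, mem_filter, mem_range]
    constructor
    · intro hk
      refine ⟨?_, hk⟩
      by_contra hk'
      exact hk (hv k (by omega))
    · exact fun h => h.2
  have ha := (hmem a).2 (Or.inl rfl)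
  have hb := (hmem b).2 (Or.inr rfl)
  have ha24 : a < 24 := by
    by_contra hk
    exact ha (hv a (by omega))
  have hb24 : b < 24 := by
    by_contra hk
    exact hb (hv b (by omega))
  have hva := hval a
  have hvb := hval b
  have hz : ∀ k, k ≠ a → k ≠ b → v k = 0 := by
    intro k h1 h2
    by_contra h3
    have := (hmem k).1 h3
    tauto
  rcases lt_or_gt_of_ne hab with hlt | hlt
  · refine ⟨a, b, hlt, hb24, v a, v b, by omega, by omega, fun i => ?_⟩
    split_ifs with h1 h2
    · rw [htv, h1]
    · rw [htv, h2]
    · rw [htv, hz i h1 h2, mul_zero]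
  · refine ⟨b, a, hlt, ha24, v b, v a, by omega, by omega, fun i => ?_⟩
    split_ifs with h1 h2
    · rw [htv, h1]
    · rw [htv, h2]
    · rw [htv, hz i h2 h1, mul_zero]

namespace IsHalfLeech

variable {z w : Fin 24 → ℤ}

/-- These are the equality cases of `eight_le_sum_sq`. The parity of the number of entries `1` comes
from `∑ z i = 2 * #plus - 8` being divisible by 4. -/
theorem isPairVector_or_isOctadVector (hz : IsHalfLeech z) (h : ∑ i, z i ^ 2 = 8) :
    IsPairVector (reorder z) ∨ IsOctadVector (reorder z) := by
  by_cases hodd : ∃ j, z j % 2 ≠ 0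
  · right
    obtain ⟨j, hj⟩ := hodd
    have h8 := hz.eight_le_sum_emod hj
    have hnn : ∀ i ∈ (univ : Finset (Fin 24)), 0 ≤ z i ^ 2 - z i % 2 := fun i _ =>
      sub_nonneg.2 (emod_two_le_sq _)
    have h0 := (sum_eq_zero_iff_of_nonneg hnn).1 (by
      have := sum_nonneg hnn
      rw [sum_sub_distrib] at this ⊢
      omega)
    have hzval : ∀ i, z i = -1 ∨ z i = 0 ∨ z i = 1 := by
      intro i
      have h1 := h0 i (mem_univ i)
      have h2 : z i ^ 2 ≤ 1 := by omega
      have h3 : z i < 2 := by nlinarith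
      have h4 : -2 < z i := by nlinarith
      omega
    have hval : ∀ k, reorder z k = -1 ∨ reorder z k = 0 ∨ reorder z k = 1 := by
      intro k
      by_cases hk : k < 24
      · rw [reorder, if_pos hk]
        exact hzval _
      · exact Or.inr (Or.inl (reorder_eq_zero (by omega)))
    have hcard : #(supp24 (reorder z)) = 8 := by
      have : ((#(supp24 (reorder z)) : ℕ) : ℤ) = ∑ i, z i ^ 2 := by
        rw [supp24, card_filter, ← sum_reorder fun a => a ^ 2]
        push_cast
        refine sum_congr rfl fun k _ => ?_
        rcases hval k with h | h | h <;> simp [h]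
      omega
    refine ⟨hval, fun k hk => reorder_eq_zero hk, hcard, ?_⟩
    have hsum : ∑ i, z i = 2 * (#(plus24 (reorder z)) : ℤ) - #(supp24 (reorder z)) := by
      rw [supp24, plus24, card_filter, card_filter, ← sum_reorder fun a => a]
      push_cast
      rw [mul_sum, ← sum_sub_distrib]
      refine sum_congr rfl fun k _ => ?_
      rcases hval k with h | h | h <;> simp [h]
    have := hz.sum
    omega
  · left
    push Not at hodd
    have hev : ∀ k, reorder z k = 2 * (reorder z k / 2) := by
      intro k
      have : reorder z k % 2 = 0 := by
        by_cases hk : k < 24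
        · rw [reorder, if_pos hk]
          exact hodd _
        · rw [reorder_eq_zero (by omega)]
          rfl
      omega
    refine isPairVector_of_sum_sq hev (fun k hk => by rw [reorder_eq_zero hk]; rfl) ?_
    have h1 : ∑ k ∈ range 24, reorder z k ^ 2 = 4 * ∑ k ∈ range 24, (reorder z k / 2) ^ 2 := by
      rw [mul_sum]
      refine sum_congr rfl fun k _ => ?_
      conv_lhs => rw [hev k]
      ring
    rw [sum_reorder fun a => a ^ 2] at h1
    omega

/-- The sum `z + w` has `16 - 2 * #(intersection)` odd coordinates, and at least 8 as the octads
differ. -/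
theorem card_inter_le_four (hz : IsHalfLeech z) (hw : IsHalfLeech w)
    (hzo : IsOctadVector (reorder z)) (hwo : IsOctadVector (reorder w))
    (h : supp24 (reorder z) ≠ supp24 (reorder w)) :
    #(supp24 (reorder z) ∩ supp24 (reorder w)) ≤ 4 := by
  set t := reorder z
  set u := reorder w
  have hadd : ∀ k, reorder (z + w) k = t k + u k := by
    intro k
    by_cases hk : k < 24
    · simp [t, u, reorder, hk]
    · simp [t, u, reorder, hk]
  have hinter : supp24 t ∩ supp24 u = {k ∈ range 24 | t k ≠ 0 ∧ u k ≠ 0} := by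
    rw [supp24, supp24, filter_and]
  have hsum : ∑ i, (z + w) i % 2 = 16 - 2 * (#(supp24 t ∩ supp24 u) : ℤ) := by
    have h16 : (16 : ℤ) = #(supp24 t) + #(supp24 u) := by
      rw [hzo.card, hwo.card]
      norm_num
    rw [← sum_reorder fun a => a % 2, h16, hinter, supp24, supp24, card_filter, card_filter,
      card_filter]
    push_cast
    rw [mul_sum, ← sum_add_distrib, ← sum_sub_distrib]
    refine sum_congr rfl fun k _ => ?_
    rw [hadd]
    rcases hzo.val k with h1 | h1 | h1 <;> rcases hwo.val k with h2 | h2 | h2 <;>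
      simp [t, u, h1, h2]
  have hex : ∃ k, k < 24 ∧ (t k + u k) % 2 ≠ 0 := by
    by_contra hno
    push Not at hno
    refine h (Finset.ext fun k => ?_)
    rw [hzo.mem_supp24, hwo.mem_supp24]
    by_cases hk : k < 24
    · have h1 := hno k hk
      have h2 := hzo.val k
      have h3 := hwo.val k
      omega
    · rw [hzo.zero k (by omega), hwo.zero k (by omega)]
  obtain ⟨k, hk, hodd⟩ := hex
  have := (hz.add hw).eight_le_sum_emod (j := coordPlace k) (by
    rw [← hadd, reorder, if_pos hk] at hodd
    exact hodd)
  omega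

end IsHalfLeech

/-- A zero coordinate forces `a = 0`, since `a` is the common parity of all coordinates. -/
theorem isHalfLeech_of_mem_leechLattice {x : Fin 24 → ℤ} (hx : x ∈ leechLattice) {j : Fin 24}
    (hj : x j = 0) : ∃ z, IsHalfLeech z ∧ ∀ i, x i = 2 * z i := by
  obtain ⟨a, ha, b, hb, c, d, hc, hsum, hxi⟩ := hx
  have ha0 : a = 0 := by
    have := hxi j
    omega
  subst ha0
  refine ⟨fun i => (b i).val + 2 * c i + 4 * d i, ⟨?_, ?_⟩, fun i => ?_⟩
  · convert hb using 1
    funext i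
    have h2 : (2 : ZMod 2) = 0 := rfl
    have h4 : (4 : ZMod 2) = 0 := rfl
    simp [h2, h4]
  · rw [sum_add_distrib, sum_add_distrib, ← mul_sum, ← mul_sum]
    have h1 := (golay_weight hb).1
    have h2 : (4 : ℤ) ∣ ∑ i, ((b i).val : ℤ) := by exact_mod_cast h1
    rw [Int.modEq_zero_iff_dvd] at hsum
    omega
  · rw [hxi i]
    ring

/-! ### Dimension of the laminated lattices -/

/-- The coefficients of the linear form that vanishes on the laminated lattice of dimension `n` but
not on that of dimension `n + 1`. -/
def addedForm : ℕ → List (ℕ × ℤ)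
  | 23 => [(24, 1), (23, -1)]
  | 22 => [(23, 1), (22, -1)]
  | 21 => [(22, 1)]
  | 20 => [(21, 1)]
  | 19 => [(20, 1)]
  | 18 => [(19, 1), (18, 1), (17, 1)]
  | 17 => [(19, 1)]
  | 16 => [(18, 1)]
  | 15 => [(16, 1)]
  | 14 => [(15, 1), (14, 1), (13, 1)]
  | 13 => [(15, 1)]
  | 12 => [(14, 1)]
  | 11 => [(12, 1), (11, -1)]
  | 10 => [(11, 1), (10, -1)]
  | 9 => [(10, 1)]
  | 8 => [(9, 1)]
  | 7 => [(8, 1), (7, -1)]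
  | 6 => [(7, 1), (6, -1)]
  | 5 => [(6, 1)]
  | 4 => [(5, 1)]
  | 3 => [(4, 1)]
  | 2 => [(3, 1), (2, 1), (1, 1)]
  | 1 => [(3, 1)]
  | _ => []

/-- The value of the linear form with the coefficients `l` at `y`. -/
def formValue {R : Type*} [Ring R] (l : List (ℕ × ℤ)) (y : ℕ → R) : R :=
  (l.map fun p => (p.2 : R) * y p.1).sum

theorem addedCondition_iff (x : Fin 24 → ℤ) {n : ℕ} (hn₁ : 1 ≤ n) (hn : n ≤ 23) :
    addedCondition x n ↔ formValue (addedForm n) (coord x) = 0 := by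
  interval_cases n <;> simp [addedCondition, addedForm, formValue] <;> omega

theorem formValue_add (l : List (ℕ × ℤ)) (y y' : ℕ → ℝ) :
    formValue l (fun k => y k + y' k) = formValue l y + formValue l y' := by
  induction l with
  | nil => simp [formValue]
  | cons p l ih =>
    simp only [formValue, List.map_cons, List.sum_cons] at ih ⊢
    rw [ih]
    ring

theorem formValue_mul (l : List (ℕ × ℤ)) (a : ℝ) (y : ℕ → ℝ) :
    formValue l (fun k => a * y k) = a * formValue l y := by
  induction l with
  | nil => simp [formValue]
  | cons p l ih =>
    simp only [formValue, List.map_cons, List.sum_cons] at ih ⊢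
    rw [ih]
    ring

theorem formValue_intCast (l : List (ℕ × ℤ)) (y : ℕ → ℤ) :
    formValue l (fun k => (y k : ℝ)) = (formValue l y : ℤ) := by
  induction l with
  | nil => simp [formValue]
  | cons p l ih =>
    simp only [formValue, List.map_cons, List.sum_cons] at ih ⊢
    rw [ih]
    push_cast
    rfl

/-- The coordinates, in the order of `coordOrder`, of an eighth of a vector of the laminated lattice
of dimension `n + 1` that does not lie in that of dimension `n`. -/
def newVectorCoords : ℕ → List (ℕ × ℤ)
  | 23 => [(24, 1)]
  | 22 => [(22, 1)]
  | 21 => [(22, 1), (23, 1), (24, 1)]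
  | 20 => [(21, 1)]
  | 19 => [(20, 1)]
  | 18 => [(17, 1)]
  | 17 => [(19, 1), (17, -1)]
  | 16 => [(18, 1), (17, -1)]
  | 15 => [(16, 1)]
  | 14 => [(13, 1)]
  | 13 => [(15, 1), (13, -1)]
  | 12 => [(14, 1), (13, -1)]
  | 11 => [(11, 1)]
  | 10 => [(10, 1)]
  | 9 => [(10, 1), (11, 1), (12, 1)]
  | 8 => [(9, 1)]
  | 7 => [(7, 1)]
  | 6 => [(6, 1)]
  | 5 => [(6, 1), (7, 1), (8, 1)]
  | 4 => [(5, 1)]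
  | 3 => [(4, 1)]
  | 2 => [(1, 1)]
  | 1 => [(3, 1), (1, -1)]
  | _ => [(2, 1), (1, -1)]

/-- A vector of the laminated lattice of dimension `n + 1` that does not lie in that of dimension
`n`. -/
def newVector (n : ℕ) (i : Fin 24) : ℤ :=
  8 * formValue (newVectorCoords n) fun k => if coordPlace (k - 1) = i then 1 else 0

theorem newVector_mem_leechLattice (n : ℕ) : newVector n ∈ leechLattice :=
  -- All coordinates are multiples of 8, so the `d i` alone represent the vector.
  ⟨0, Or.inl rfl, 0, golayCode.zero_mem, 0, _, fun _ => Or.inl rfl, by simp,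
    fun i => by simp [newVector]; rfl⟩

theorem formValue_newVector : ∀ n < 24, ∀ m < 24, n < m →
    formValue (addedForm m) (coord (newVector n)) = 0 := by
  decide +kernel

theorem formValue_newVector_ne : ∀ n < 24, 0 < n →
    formValue (addedForm n) (coord (newVector n)) ≠ 0 := by
  decide +kernel

theorem formValue_eq_zero_of_mem_span {n : ℕ} (hn₁ : 1 ≤ n) (hn : n ≤ 23)
    {v : EuclideanSpace ℝ (Fin 24)} (hv : v ∈ Submodule.span ℝ (laminatedLattice n)) :
    formValue (addedForm n) (fun k => v (coordPlace (k - 1))) = 0 := by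
  induction hv using Submodule.span_induction with
  | mem v hv =>
    obtain ⟨x, ⟨-, hx⟩, rfl⟩ := hv
    have h := (addedCondition_iff x hn₁ hn).1 (hx n le_rfl hn)
    have h2 := formValue_intCast (addedForm n) (coord x)
    rw [h, Int.cast_zero] at h2
    exact h2
  | zero => simp [formValue]
  | add v w _ _ hv hw =>
    have := formValue_add (addedForm n) (fun k => v (coordPlace (k - 1)))
      (fun k => w (coordPlace (k - 1)))
    rw [hv, hw, add_zero] at this
    exact this
  | smul a v _ hv =>
    have := formValue_mul (addedForm n) a (fun k => v (coordPlace (k - 1)))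
    rw [hv, mul_zero] at this
    exact this

theorem newVector_mem_laminatedLattice {n : ℕ} (hn : n ≤ 23) :
    toEuclidean24 (newVector n) ∈ laminatedLattice (n + 1) :=
  ⟨_, ⟨newVector_mem_leechLattice n, fun m h1 h2 =>
    (addedCondition_iff _ (by omega) h2).2 (formValue_newVector n (by omega) m (by omega) h1)⟩, rfl⟩

theorem laminatedLattice_mono {m n : ℕ} (h : m ≤ n) : laminatedLattice m ⊆ laminatedLattice n :=
  Set.image_mono fun _ hx => ⟨hx.1, fun k hk => hx.2 k (h.trans hk)⟩

theorem span_laminatedLattice_lt {n : ℕ} (hn₁ : 1 ≤ n) (hn : n ≤ 23) :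
    Submodule.span ℝ (laminatedLattice n) < Submodule.span ℝ (laminatedLattice (n + 1)) := by
  refine lt_of_le_of_ne (Submodule.span_mono (laminatedLattice_mono (Nat.le_succ n))) fun h => ?_
  have h1 : toEuclidean24 (newVector n) ∈ Submodule.span ℝ (laminatedLattice n) := by
    rw [h]
    exact Submodule.subset_span (newVector_mem_laminatedLattice hn)
  have h2 := formValue_eq_zero_of_mem_span hn₁ hn h1
  have h3 := formValue_intCast (addedForm n) (coord (newVector n))
  have h4 : ((formValue (addedForm n) (coord (newVector n)) : ℤ) : ℝ) = 0 := h3.symm.trans h2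
  exact formValue_newVector_ne n (by omega) hn₁ (by exact_mod_cast h4)

theorem one_le_finrank_laminatedLattice_one :
    1 ≤ Module.finrank ℝ (Submodule.span ℝ (laminatedLattice 1)) := by
  rw [Nat.one_le_iff_ne_zero, Ne, Submodule.finrank_eq_zero]
  intro h
  have h1 := Submodule.subset_span (R := ℝ) (newVector_mem_laminatedLattice (n := 0) (by omega))
  rw [zero_add, h, SetLike.mem_coe, Submodule.mem_bot] at h1
  have h2 := congrArg (fun v : EuclideanSpace ℝ (Fin 24) => v (coordPlace 1)) h1
  have h3 : newVector 0 (coordPlace 1) = 8 := by decide +kernel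
  simp [toEuclidean24, h3] at h2

/-- The spans grow strictly at each of the 23 steps, from dimension at least 1 to at most 24.
Counting up bounds each dimension from below, counting down from above. -/
theorem finrank_laminatedLattice {n : ℕ} (hn₁ : 1 ≤ n) (hn : n ≤ 24) :
    Module.finrank ℝ (Submodule.span ℝ (laminatedLattice n)) = n := by
  have hlower : ∀ k, k ≤ 23 →
      k + 1 ≤ Module.finrank ℝ (Submodule.span ℝ (laminatedLattice (k + 1))) := by
    intro k hk
    induction k with
    | zero => exact one_le_finrank_laminatedLattice_one
    | succ k ih =>
      have := Submodule.finrank_lt_finrank_of_lt (span_laminatedLattice_lt (n := k + 1) (by omega) hk)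
      have := ih (by omega)
      omega
  have hupper : ∀ k, k ≤ 23 →
      Module.finrank ℝ (Submodule.span ℝ (laminatedLattice (24 - k))) ≤ 24 - k := by
    intro k hk
    induction k with
    | zero =>
      refine (Submodule.finrank_le _).trans ?_
      simp
    | succ k ih =>
      have h := Submodule.finrank_lt_finrank_of_lt
        (span_laminatedLattice_lt (n := 24 - (k + 1)) (by omega) (by omega))
      rw [show 24 - (k + 1) + 1 = 24 - k by omega] at h
      have := ih (by omega)
      omega
  have h1 := hlower (n - 1) (by omega)
  have h2 := hupper (24 - n) (by omega)
  rw [show n - 1 + 1 = n by omega] at h1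
  rw [show 24 - (24 - n) = n by omega] at h2
  omega

/-! ### Relations between the last coordinates -/

/-- Whether the last two or three coordinates of the laminated lattice of dimension `n` have sum
zero. -/
def lastOpposite (n : ℕ) : Bool := decide (n ∈ [1, 2, 13, 14, 17, 18])

set_option maxHeartbeats 4000000 in
theorem lastCoords_reorder {n : ℕ} (hn₁ : 1 ≤ n) (hn : n ≤ 21) {x z : Fin 24 → ℤ}
    (hxz : ∀ i, x i = 2 * z i) (hx : ∀ m, n ≤ m → m ≤ 23 → addedCondition x m) :
    LastCoords (lastOpposite n) n (reorder z) := by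
  have hc : ∀ k, k < 24 → coord x (k + 1) = 2 * reorder z k := by
    intro k hk
    rw [reorder, if_pos hk]
    exact hxz _
  have hz : ∀ m, n ≤ m → 1 ≤ m → m ≤ 23 →
      formValue (addedForm m) (fun k => reorder z (k - 1)) = 0 := by
    intro m h1 h2 h3
    have h := (addedCondition_iff x h2 h3).1 (hx m h1 h3)
    interval_cases m <;>
      simp [addedForm, formValue, hc 0, hc 1, hc 2, hc 3, hc 4, hc 5, hc 6, hc 7, hc 8, hc 9, hc 10,
        hc 11, hc 12, hc 13, hc 14, hc 15, hc 16, hc 17, hc 18, hc 19, hc 20, hc 21, hc 22,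
        hc 23] at h ⊢ <;> omega
  have ht : ∀ k, 24 ≤ k → reorder z k = 0 := fun k hk => reorder_eq_zero hk
  generalize reorder z = t at hz ht ⊢
  have key : ∀ m, 1 ≤ m → m ≤ 23 → n ≤ m → formValue (addedForm m) (fun k => t (k - 1)) = 0 :=
    fun m h1 h2 h3 => hz m h3 h1 h2
  have h23 := key 23 (by omega) (by omega)
  have h22 := key 22 (by omega) (by omega)
  have h21 := key 21 (by omega) (by omega)
  have h20 := key 20 (by omega) (by omega)
  have h19 := key 19 (by omega) (by omega)
  have h18 := key 18 (by omega) (by omega)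
  have h17 := key 17 (by omega) (by omega)
  have h16 := key 16 (by omega) (by omega)
  have h15 := key 15 (by omega) (by omega)
  have h14 := key 14 (by omega) (by omega)
  have h13 := key 13 (by omega) (by omega)
  have h12 := key 12 (by omega) (by omega)
  have h11 := key 11 (by omega) (by omega)
  have h10 := key 10 (by omega) (by omega)
  have h9 := key 9 (by omega) (by omega)
  have h8 := key 8 (by omega) (by omega)
  have h7 := key 7 (by omega) (by omega)
  have h6 := key 6 (by omega) (by omega)
  have h5 := key 5 (by omega) (by omega)
  have h4 := key 4 (by omega) (by omega)
  have h3 := key 3 (by omega) (by omega)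
  have h2 := key 2 (by omega) (by omega)
  have h1 := key 1 (by omega) (by omega)
  clear key hz hx hc
  simp only [addedForm, formValue, List.map_cons, List.map_nil, List.sum_cons, List.sum_nil,
    Int.cast_one, one_mul, add_zero, Int.reduceNeg, Int.cast_neg, neg_mul,
    Nat.sub_self, Nat.add_one_sub_one] at *
  -- For each `n` only the conditions with index at least `n` survive; they form a small linear
  -- system for `omega`.
  interval_cases n <;>
    simp only [Nat.reduceLeDiff, forall_const, false_imp_iff] at * <;>
    refine ⟨fun ho => ?_, fun ho => ?_⟩ <;>
    first
    | exact absurd ho (by decide)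
    | refine ⟨fun i hi => ?_, ?_⟩
      · rcases Nat.lt_or_ge i 24 with hi' | hi'
        · interval_cases i <;> omega
        · exact ht i hi'
      · simp only [Nat.sub_self, Nat.reduceSub, Nat.add_one_sub_one]
        omega
    | refine ⟨by norm_num, fun i hi => ?_, ?_⟩
      · rcases Nat.lt_or_ge i 24 with hi' | hi'
        · interval_cases i <;> omega
        · exact ht i hi'
      · simp only [Nat.reduceAdd, Nat.add_one_sub_one]
        omega

/-! ### Distances and the division into parts -/

theorem dist_toEuclidean24 (x y : Fin 24 → ℤ) :
    dist (toEuclidean24 x) (toEuclidean24 y) = √((∑ i, (x i - y i) ^ 2 : ℤ) : ℝ) := by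
  rw [EuclideanSpace.dist_eq]
  simp [toEuclidean24, Real.dist_eq, sq_abs]

theorem norm_toEuclidean24 (x : Fin 24 → ℤ) :
    ‖toEuclidean24 x‖ = √((∑ i, x i ^ 2 : ℤ) : ℝ) := by
  rw [EuclideanSpace.norm_eq]
  simp [toEuclidean24]

theorem neg_toEuclidean24 (x : Fin 24 → ℤ) : -toEuclidean24 x = toEuclidean24 (-x) := by
  ext i
  simp [toEuclidean24]

/-- The halves of the coordinates of a vector with even integral coordinates. -/
noncomputable def halfCoords (v : EuclideanSpace ℝ (Fin 24)) (i : Fin 24) : ℤ := ⌊v i / 2⌋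

/-- The properties of the minimal vectors that the division into parts depends on. -/
structure IsMinimal (n : ℕ) (v : EuclideanSpace ℝ (Fin 24)) : Prop where
  eq : v = toEuclidean24 fun i => 2 * halfCoords v i
  half : IsHalfLeech (halfCoords v)
  sum_sq : ∑ i, halfCoords v i ^ 2 = 8
  last : LastCoords (lastOpposite n) n (reorder (halfCoords v))

theorem isMinimal_of_mem {n : ℕ} (hn₁ : 1 ≤ n) (hn : n ≤ 21) {v : EuclideanSpace ℝ (Fin 24)}
    (hv : v ∈ minimalVectors n) : IsMinimal n v := by
  obtain ⟨⟨x, ⟨hx, hcond⟩, rfl⟩, hnorm⟩ := hv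
  -- The condition added at dimension 21 supplies the vanishing coordinate; this is where `n ≤ 21`
  -- is essential.
  obtain ⟨z, hz, hxz⟩ := isHalfLeech_of_mem_leechLattice hx (hcond 21 hn (by norm_num))
  have hhalf : halfCoords (toEuclidean24 x) = z := by
    funext i
    have : (toEuclidean24 x).ofLp i / 2 = (z i : ℝ) := by
      simp [toEuclidean24, hxz i]
    rw [halfCoords, this, Int.floor_intCast]
  have hsum : ∑ i, x i ^ 2 = 4 * ∑ i, z i ^ 2 := by
    rw [mul_sum]
    refine sum_congr rfl fun i _ => ?_
    rw [hxz i]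
    ring
  refine ⟨?_, by rwa [hhalf], ?_, ?_⟩
  · rw [hhalf]
    congr 1
    funext i
    exact hxz i
  · rw [hhalf]
    rw [norm_toEuclidean24, Real.sqrt_inj (by exact_mod_cast sum_nonneg fun i _ => sq_nonneg (x i))
      (by norm_num)] at hnorm
    have : ∑ i, x i ^ 2 = 32 := by exact_mod_cast hnorm
    omega
  · rw [hhalf]
    exact lastCoords_reorder hn₁ hn hxz hcond

namespace IsMinimal

variable {n : ℕ} {v w : EuclideanSpace ℝ (Fin 24)}

theorem dist_eq (hv : IsMinimal n v) (hw : IsMinimal n w) :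
    dist v w = √((64 - 8 * ∑ i, halfCoords v i * halfCoords w i : ℤ) : ℝ) := by
  conv_lhs => rw [hv.eq, hw.eq]
  rw [dist_toEuclidean24]
  congr 2
  have h1 : ∑ i, (2 * halfCoords v i - 2 * halfCoords w i) ^ 2 =
      4 * ∑ i, halfCoords v i ^ 2 + 4 * ∑ i, halfCoords w i ^ 2 -
        8 * ∑ i, halfCoords v i * halfCoords w i := by
    rw [mul_sum, mul_sum, mul_sum, ← sum_add_distrib, ← sum_sub_distrib]
    refine sum_congr rfl fun i _ => ?_
    ring
  rw [h1, hv.sum_sq, hw.sum_sq]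
  ring

/-- The halves have a nonzero sum, so `8 + 8 + 2 p ≥ 8` for their inner product `p`, that is, `p ≥
-4`. -/
theorem dist_le (hv : IsMinimal n v) (hw : IsMinimal n w) (hne : v ≠ -w) : dist v w ≤ √96 := by
  have h0 : halfCoords v + halfCoords w ≠ 0 := by
    intro h
    refine hne ?_
    rw [hv.eq, hw.eq, neg_toEuclidean24]
    congr 1
    funext i
    have := congrFun h i
    simp only [Pi.add_apply, Pi.zero_apply] at this
    simp only [Pi.neg_apply]
    omega
  have h1 := (hv.half.add hw.half).eight_le_sum_sq h0
  have h2 : ∑ i, (halfCoords v + halfCoords w) i ^ 2 = ∑ i, halfCoords v i ^ 2 +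
      ∑ i, halfCoords w i ^ 2 + 2 * ∑ i, halfCoords v i * halfCoords w i := by
    rw [mul_sum, ← sum_add_distrib, ← sum_add_distrib]
    refine sum_congr rfl fun i _ => ?_
    simp only [Pi.add_apply]
    ring
  rw [h2, hv.sum_sq, hw.sum_sq] at h1
  rw [hv.dist_eq hw]
  refine Real.sqrt_le_sqrt ?_
  exact_mod_cast (by omega : 64 - 8 * ∑ i, halfCoords v i * halfCoords w i ≤ 96)

theorem dist_le_of_colour_eq (hn : 1 ≤ n) (hv : IsMinimal n v) (hw : IsMinimal n w)
    (h : colour (lastOpposite n) n (reorder (halfCoords v)) =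
      colour (lastOpposite n) n (reorder (halfCoords w))) : dist v w ≤ √88 := by
  have h1 := neg_three_le_dot24_of_colour_eq hn (hv.half.isPairVector_or_isOctadVector hv.sum_sq)
    (hw.half.isPairVector_or_isOctadVector hw.sum_sq) hv.last hw.last
    (hv.half.card_inter_le_four hw.half) h
  rw [dot24_reorder] at h1
  rw [hv.dist_eq hw]
  refine Real.sqrt_le_sqrt ?_
  exact_mod_cast (by omega : 64 - 8 * ∑ i, halfCoords v i * halfCoords w i ≤ 88)

end IsMinimal

/-- A uniform bound `e < d` is required because the diameter is a supremum; here it will be `√88 <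
√96`. -/
theorem divisibleInto_of_colouring {m k : ℕ} {M : Set (EuclideanSpace ℝ (Fin m))} {d e : ℝ}
    (c : EuclideanSpace ℝ (Fin m) → ℕ) (hc : ∀ v ∈ M, c v < k) (he : 0 ≤ e) (hed : e < d)
    (hdist : ∀ v ∈ M, ∀ w ∈ M, c v = c w → dist v w ≤ e) : DivisibleInto M k d := by
  refine ⟨fun i => {v ∈ M | c v = i}, ?_, ?_, fun i => ⟨?_, ?_⟩⟩
  · ext v
    simp only [Set.mem_iUnion, Set.mem_ofPred_eq]
    constructor
    · rintro ⟨i, hv, -⟩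
      exact hv
    · exact fun hv => ⟨⟨c v, hc v hv⟩, hv, rfl⟩
  · intro i j hij
    rw [Set.disjoint_left]
    rintro v ⟨-, h1⟩ ⟨-, h2⟩
    exact hij (Fin.ext (h1.symm.trans h2))
  · rw [Metric.isBounded_iff]
    exact ⟨e, fun v hv w hw => hdist v hv.1 w hw.1 (hv.2.trans hw.2.symm)⟩
  · exact (Metric.diam_le_of_forall_dist_le he fun v hv w hw =>
      hdist v hv.1 w hw.1 (hv.2.trans hw.2.symm)).trans_lt hed

theorem DivisibleInto.mono {m k : ℕ} {S M : Set (EuclideanSpace ℝ (Fin m))} {d : ℝ}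
    (h : DivisibleInto M k d) (hS : S ⊆ M) : DivisibleInto S k d := by
  obtain ⟨P, hU, hP, hd⟩ := h
  refine ⟨fun i => P i ∩ S, ?_, fun i j hij => ?_, fun i => ⟨?_, ?_⟩⟩
  · rw [← Set.iUnion_inter, hU]
    exact Set.inter_eq_right.2 hS
  · exact (hP i j hij).mono Set.inter_subset_left Set.inter_subset_left
  · exact (hd i).1.subset Set.inter_subset_left
  · exact (Metric.diam_mono Set.inter_subset_left (hd i).1).trans_lt (hd i).2

theorem divisibleInto_minimalVectors {n : ℕ} (hn₁ : 1 ≤ n) (hn : n ≤ 21) :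
    DivisibleInto (minimalVectors n) (n + 1) (√96) := by
  refine divisibleInto_of_colouring
    (fun v => colour (lastOpposite n) n (reorder (halfCoords v))) (fun v hv => ?_)
    (Real.sqrt_nonneg 88) (Real.sqrt_lt_sqrt (by norm_num) (by norm_num)) fun v hv w hw h => ?_
  · have hv := isMinimal_of_mem hn₁ hn hv
    exact Nat.lt_succ_of_le
      (colour_le hn₁ (hv.half.isPairVector_or_isOctadVector hv.sum_sq) hv.last)
  · exact (isMinimal_of_mem hn₁ hn hv).dist_le_of_colour_eq hn₁ (isMinimal_of_mem hn₁ hn hw) h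

/-! ### The diameter of half systems -/

/-- The minimal vector with 4 and -4 at the places `a` and `b` of the order `coordOrder`. -/
def rootVector (a b : ℕ) (i : Fin 24) : ℤ :=
  if i = coordPlace a then 4 else if i = coordPlace b then -4 else 0

theorem rootVector_mem_leechLattice {a b : ℕ} (h : coordPlace a ≠ coordPlace b) :
    rootVector a b ∈ leechLattice := by
  -- Writing `-4 = 4 - 8` puts a `1` into `c` at both places, so that `∑ c i = 2` is even.
  refine ⟨0, Or.inl rfl, 0, golayCode.zero_mem,
    fun i => (if i = coordPlace a then 1 else 0) + if i = coordPlace b then 1 else 0,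
    fun i => if i = coordPlace b then -1 else 0, fun i => ?_, ?_, fun i => ?_⟩
  · beta_reduce
    split_ifs with h1 h2
    · exact absurd (h1.symm.trans h2) h
    all_goals simp
  · rw [sum_add_distrib, sum_ite_eq', sum_ite_eq']
    simp only [mem_univ, if_true]
    rfl
  · simp only [rootVector, Pi.zero_apply]
    split_ifs with h1 h2
    · exact absurd (h1.symm.trans h2) h
    all_goals simp

theorem rootVector_mem_minimalVectors {a b : ℕ} (h : coordPlace a ≠ coordPlace b)
    (hcond : ∀ m < 24, 2 ≤ m → formValue (addedForm m) (coord (rootVector a b)) = 0)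
    (hnorm : ∑ i, rootVector a b i ^ 2 = 32) {n : ℕ} (hn : 2 ≤ n) :
    toEuclidean24 (rootVector a b) ∈ minimalVectors n := by
  refine ⟨⟨_, ⟨rootVector_mem_leechLattice h, fun m h1 h2 => ?_⟩, rfl⟩, ?_⟩
  · exact (addedCondition_iff _ (by omega) h2).2 (hcond m (by omega) (by omega))
  · rw [norm_toEuclidean24, hnorm]
    norm_num

/-- The three vectors have sum zero and live on the first three places, so they satisfy every
condition added at a dimension from 2 on. -/
theorem hexagon (n : ℕ) (hn : 2 ≤ n) :
    (toEuclidean24 (rootVector 0 1) ∈ minimalVectors n ∧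
      toEuclidean24 (rootVector 1 2) ∈ minimalVectors n ∧
      toEuclidean24 (rootVector 2 0) ∈ minimalVectors n) ∧
    dist (toEuclidean24 (rootVector 0 1)) (toEuclidean24 (rootVector 1 2)) = √96 ∧
    dist (toEuclidean24 (rootVector 1 2)) (toEuclidean24 (rootVector 2 0)) = √96 ∧
    dist (toEuclidean24 (rootVector 2 0)) (toEuclidean24 (rootVector 0 1)) = √96 := by
  refine ⟨⟨?_, ?_, ?_⟩, ?_, ?_, ?_⟩
  · exact rootVector_mem_minimalVectors (by decide) (by decide +kernel) (by decide +kernel) hn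
  · exact rootVector_mem_minimalVectors (by decide) (by decide +kernel) (by decide +kernel) hn
  · exact rootVector_mem_minimalVectors (by decide) (by decide +kernel) (by decide +kernel) hn
  · rw [dist_toEuclidean24,
      show ∑ i, (rootVector 0 1 i - rootVector 1 2 i) ^ 2 = 96 by decide +kernel]
    norm_num
  · rw [dist_toEuclidean24,
      show ∑ i, (rootVector 1 2 i - rootVector 2 0 i) ^ 2 = 96 by decide +kernel]
    norm_num
  · rw [dist_toEuclidean24,
      show ∑ i, (rootVector 2 0 i - rootVector 0 1 i) ^ 2 = 96 by decide +kernel]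
    norm_num

theorem diam_of_mem_halfSystems {n : ℕ} (hn₂ : 2 ≤ n) (hn : n ≤ 21)
    {S : Set (EuclideanSpace ℝ (Fin 24))} (hS : S ∈ halfSystems n) : Metric.diam S = √96 := by
  obtain ⟨hsub, hxor⟩ := hS
  have hle : ∀ v ∈ S, ∀ w ∈ S, dist v w ≤ √96 := by
    intro v hv w hw
    refine (isMinimal_of_mem (by omega) hn (hsub hv)).dist_le
      (isMinimal_of_mem (by omega) hn (hsub hw)) fun h => ?_
    rcases hxor w (hsub hw) with ⟨-, h1⟩ | ⟨-, h1⟩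
    · exact h1 (h ▸ hv)
    · exact h1 hw
  have hb : Bornology.IsBounded S := Metric.isBounded_iff.2 ⟨_, fun v hv w hw => hle v hv w hw⟩
  refine le_antisymm (Metric.diam_le_of_forall_dist_le (Real.sqrt_nonneg _) hle) ?_
  obtain ⟨⟨h1, h2, h3⟩, d12, d23, d31⟩ := hexagon n hn₂
  have hor : ∀ v ∈ minimalVectors n, v ∈ S ∨ -v ∈ S := fun v hv =>
    (hxor v hv).imp (fun h => h.1) (fun h => h.1)
  have key : ∀ v w : EuclideanSpace ℝ (Fin 24), dist v w = √96 →
      (v ∈ S ∧ w ∈ S ∨ -v ∈ S ∧ -w ∈ S) → √96 ≤ Metric.diam S := by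
    rintro v w hd (⟨hv, hw⟩ | ⟨hv, hw⟩)
    · rw [← hd]
      exact Metric.dist_le_diam_of_mem hb hv hw
    · rw [← hd, ← dist_neg_neg]
      exact Metric.dist_le_diam_of_mem hb hv hw
  have := key _ _ d12
  have := key _ _ d23
  have := key _ _ d31
  have := hor _ h1
  have := hor _ h2
  have := hor _ h3
  -- Each of three vectors occurs with one of two signs, so two of them occur with the same sign.
  tauto

/-- On a line two distinct vectors of equal norm are opposite, and a half system never contains
both. -/
theorem not_nontrivial_of_mem_halfSystems_one {S : Set (EuclideanSpace ℝ (Fin 24))}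
    (hS : S ∈ halfSystems 1) : ¬ S.Nontrivial := by
  rintro ⟨v, hv, w, hw, hne⟩
  obtain ⟨hsub, hxor⟩ := hS
  have hvm := hsub hv
  have hwm := hsub hw
  have hv0 : v ≠ 0 := by
    intro h
    have h1 := hvm.2
    rw [h, norm_zero] at h1
    exact (Real.sqrt_pos.2 (by norm_num : (0 : ℝ) < 32)).ne h1
  have hfin := finrank_laminatedLattice (n := 1) le_rfl (by norm_num)
  obtain ⟨c, hc⟩ := exists_smul_eq_of_finrank_eq_one hfin
    (x := ⟨v, Submodule.subset_span hvm.1⟩) (by simpa using hv0)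
    ⟨w, Submodule.subset_span hwm.1⟩
  have hcv : c • v = w := congrArg Subtype.val hc
  have hc1 : |c| = 1 := by
    have h1 : |c| * ‖v‖ = ‖w‖ := by rw [← hcv, norm_smul, Real.norm_eq_abs]
    rw [hvm.2, hwm.2] at h1
    exact mul_right_cancel₀ (Real.sqrt_pos.2 (by norm_num : (0 : ℝ) < 32)).ne' (by rw [h1, one_mul])
  rcases eq_or_eq_neg_of_abs_eq hc1 with rfl | rfl
  · exact hne (by rw [← hcv, one_smul])
  · rw [neg_smul, one_smul] at hcv
    rcases hxor v hvm with ⟨-, h⟩ | ⟨-, h⟩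
    · exact h (hcv ▸ hw)
    · exact h hv

/-- For `1 ≤ n ≤ 21` the laminated lattice `Λ_n` is `n`-dimensional, its set `M_n` of minimal vectors
can be divided into at most `n + 1` parts of diameter below `√96`, and so can every element of `H_n`;
these have diameter `√96` (for `n = 1` they are single points), so that none of them is a
counterexample to Borsuk's conjecture. -/
theorem mainTheorem1 (n : ℕ) (hn₁ : 1 ≤ n) (hn₂ : n ≤ 21) :
    Module.finrank ℝ (Submodule.span ℝ (laminatedLattice n)) = n ∧
    DivisibleInto (minimalVectors n) (n + 1) (√96) ∧
    ∀ S ∈ halfSystems n,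
      (2 ≤ n → Metric.diam S = √96) ∧
      DivisibleInto S (n + 1) (√96) ∧
      ¬ IsBorsukCounterexample n S := by
  have hdiv := divisibleInto_minimalVectors hn₁ hn₂
  refine ⟨finrank_laminatedLattice hn₁ (by omega), hdiv, fun S hS =>
    ⟨fun h => diam_of_mem_halfSystems h hn₂ hS, hdiv.mono hS.1, ?_⟩⟩
  rintro ⟨-, hnt, -, hnot⟩
  rcases hn₁.eq_or_lt with rfl | hn
  · exact not_nontrivial_of_mem_halfSystems_one hS hnt
  · rw [diam_of_mem_halfSystems hn hn₂ hS] at hnot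
    exact hnot (hdiv.mono hS.1)
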